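/- Let $\mathrm{Ai}$, $\mathrm{Bi}$ be the standard Airy functions. For $C_1,C_2\in\mathbb{C}$ put $$\varphi(z)=C_1\,\mathrm{Ai}\big(-2^{-1/3}z\big)+C_2\,\mathrm{Bi}\big(-2^{-1/3}z\big),\qquad \tau_n(z)=\det\left(\frac{d^{j+k}}{dz^{j+k}}\varphi(z)\right)_{j,k=0}^{n-1}.$$ Let $G$ be the Barnes function, so $G(m)=\prod_{k=0}^{m-2}k!$ for integers $m\ge 1$, and let $$K_n=\frac{2^{-\frac{3n^2}{4}-\frac n6}}{\pi^{n/2}}.$$ All powers of $-z$ are principal branches, with $|\arg(-z)|<\pi$. An asymptotic expansion $f(z)\sim(-z)^{p}\sum_{j\ge0}a_j(-z)^{-3j/2}$ as $|z|\to\infty$ in a sector $|\arg(-z)|<\theta$ means that for every $N\ge0$ and every $\delta>0$ $$f(z)-(-z)^p\sum_{j<N}\frac{a_j}{(-z)^{3j/2}}=O\big((-z)^{p-3N/2}\big)\quad\text{as } |z|\to\infty,\ |\arg(-z)|\le\theta-\delta .$$ Let $n\ge1$. There are functions $\mathbf A_{n,r}(z)$ and coefficients $a^{(j)}_{n,r}$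 ($0\le r\le n$, $j\ge0$), of the form $C_1^rC_2^{n-r}$ times functions of $z$, respectively numbers, that do not depend on $C_1,C_2$ (with $0^0=1$), such that $$a_{n,r}^{(0)}=(-1)^{\lfloor r/2\rfloor}\,2^{(n-r)\left(\frac{5r}{2}+1\right)}\,C_1^r\,C_2^{n-r}\,G(r+1)\,G(n-r+1),$$ and the following hold. 1. If $C_2\ne0$, then for all $z\neq 0$ with $|\arg(-z)|<\frac{\pi}{3}$ $$\tau_n(z)=K_n(-z)^{-\frac{n^2}{4}}\sum_{r=0}^n\mathbf A_{n,r}(z)\,e^{\frac{\sqrt2}{3}(n-2r)(-z)^{3/2}},$$ and, for each $0\le r\le n$, as $|z|\to\infty$ in the sector $|\arg(-z)|<\frac{\pi}{3}$, $$\mathbf A_{n,r}(z)\sim(-z)^{\frac32 r(n-r)}\sum_{j=0}^\infty\frac{a_{n,r}^{(j)}}{(-z)^{3j/2}}.$$ 2. If $C_2=0$, then for all $z\ne0$ with $|\arg(-z)|<\pi$ $$\tau_n(z)=K_n(-z)^{-\frac{n^2}{4}}\,\mathbf A_{n,n}(z)\,e^{-\frac{\sqrt2}{3}n(-z)^{3/2}},$$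 and the expansion $\mathbf A_{n,n}(z)\sim\sum_{j\ge0}a_{n,n}^{(j)}(-z)^{-3j/2}$ holds as $|z|\to\infty$ in the larger sector $|\arg(-z)|<\pi$. -/

import Mathlib

open Asymptotics Filter Bornology

noncomputable section

/-- The integral of `exp (t ^ 3 / 3 - z * t)` along the ray `t = ω * s`, where `s` runs
from `0` to `∞`. -/
def airyRay (ω z : ℂ) : ℂ :=
  ω * ∫ s in Set.Ioi (0 : ℝ), Complex.exp ((ω * (s : ℂ)) ^ 3 / 3 - z * (ω * (s : ℂ)))

/-- The direction `exp (i π / 3)`. -/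
def airyDir : ℂ := Complex.exp ((Real.pi : ℂ) * Complex.I / 3)

/-- The direction `exp (-i π / 3)`. -/
def airyDir' : ℂ := Complex.exp (-((Real.pi : ℂ) * Complex.I / 3))

/-- The Airy function `Ai`: `1 / (2 π i)` times the integral of `exp (t ^ 3 / 3 - z * t)` along
the contour that comes in from `∞ exp (-i π / 3)` to `0` and goes out to `∞ exp (i π / 3)`. -/
def airyAi (z : ℂ) : ℂ :=
  (1 / (2 * (Real.pi : ℂ) * Complex.I)) * (airyRay airyDir z - airyRay airyDir' z)

/-- The Airy function `Bi`: `1 / (2 π)` times the sum of the integrals of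
`exp (t ^ 3 / 3 - z * t)` along the two contours that come in from `-∞` to `0` and go out
to `∞ exp (-i π / 3)` and to `∞ exp (i π / 3)`. -/
def airyBi (z : ℂ) : ℂ :=
  (1 / (2 * (Real.pi : ℂ))) *
    ((airyRay airyDir' z - airyRay (-1) z) + (airyRay airyDir z - airyRay (-1) z))

/-- The seed function `C₁ Ai(-2^(-1/3) z) + C₂ Bi(-2^(-1/3) z)`. -/
def airySeed (C₁ C₂ z : ℂ) : ℂ :=
  C₁ * airyAi (-(((2 : ℝ) ^ (-(1 / 3) : ℝ) : ℝ) : ℂ) * z) +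
    C₂ * airyBi (-(((2 : ℝ) ^ (-(1 / 3) : ℝ) : ℝ) : ℂ) * z)

/-- The `n × n` Wronskian determinant with entries `d^(j+k)/dz^(j+k)` of the seed function,
`j, k = 0, …, n - 1`. -/
def airyTau (n : ℕ) (C₁ C₂ z : ℂ) : ℂ :=
  Matrix.det (Matrix.of fun j k : Fin n =>
    iteratedDeriv ((j : ℕ) + (k : ℕ)) (airySeed C₁ C₂) z)

/-- The values of the Barnes `G` function at the nonnegative integers:
`G(0) = 0` and `G(m + 1) = 0! 1! ⋯ (m - 1)!`. -/
def barnesG : ℕ → ℕ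
  | 0 => 0
  | m + 1 => ∏ k ∈ Finset.range m, k.factorial

/-- The constant `K_n = 2^(-3n²/4 - n/6) / π^(n/2)`. -/
def tauConst (n : ℕ) : ℝ :=
  (2 : ℝ) ^ (-(3 * (n : ℝ) ^ 2 / 4) - (n : ℝ) / 6) / Real.pi ^ ((n : ℝ) / 2)

/-- The leading coefficient
`(-1)^⌊r/2⌋ 2^((n-r)(5r/2+1)) C₁^r C₂^(n-r) G(r+1) G(n-r+1)`, for `r ≤ n`. -/
def tauLeadingCoeff (n r : ℕ) (C₁ C₂ : ℂ) : ℂ :=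
  (-1) ^ (r / 2) *
    (((2 : ℝ) ^ (((n : ℝ) - (r : ℝ)) * (5 * (r : ℝ) / 2 + 1)) : ℝ) : ℂ) *
    C₁ ^ r * C₂ ^ (n - r) * (barnesG (r + 1) : ℂ) * (barnesG (n - r + 1) : ℂ)

/-- The asymptotic expansion (in the sense of Poincaré)
`f(z) ∼ (-z)^p ∑_j a_j (-z)^(-3j/2)` as `|z| → ∞` in the open sector `|arg(-z)| < θ`. As usual,
the remainder estimates are uniform on each closed subsector `|arg(-z)| ≤ θ - δ`, `δ > 0`.
All powers are principal ones. -/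
def HasSectorExpansion (θ : ℝ) (f : ℂ → ℂ) (p : ℂ) (a : ℕ → ℂ) : Prop :=
  ∀ δ : ℝ, 0 < δ → ∀ N : ℕ,
    (fun z : ℂ => f z - (-z) ^ p * ∑ j ∈ Finset.range N, a j / (-z) ^ (3 * (j : ℂ) / 2))
      =O[cobounded ℂ ⊓ 𝓟 {z : ℂ | |Complex.arg (-z)| ≤ θ - δ}]
    (fun z : ℂ => (-z) ^ (p - 3 * (N : ℂ) / 2))

end

/-!
The asymptotics of the Airy tau function are obtained from a saddle point analysis of the moments
of two linear functionals, combined with an algebraic evaluation of Hankel determinants.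

*Analysis.* The contour of `Ai` can be straightened to any vertical line `Re t = a` with `a > 0`
(`airyAi_eq_airyLine`), so that the derivatives of `Ai` are the moments of `exp (t ^ 3 / 3 - y t)`
on such a line. With `y = v ^ 4` and the line through the saddle point `t = v ^ 2`, the phase is
`-(2 / 3) v ^ 6 - v ^ 2 s ^ 2 - i s ^ 3 / 3`, where the cubic term is purely imaginary. Its
exponential is therefore approximated by its Taylor polynomial uniformly in `s`, which yields the
Poincaré expansion of all moments of `(t - v ^ 2) / v ^ 2` in the full sector `|arg y| < π`
(`exists_norm_saddleMoment_sub_sum_le`); the `m`-th moment is of order `v ^ (-3 m)`, or smaller for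
odd `m`, and its leading term is a Gaussian moment. Rotating the contours writes `Bi` as a
combination of two rotated copies of `Ai` (`airyBi_eq`), whose expansions are simultaneously valid
only for `|arg y| < π / 3`.

*Algebra.* For a sequence of moments, `n!` times the Hankel determinant is the value at the squared
Vandermonde polynomial of the functional on polynomials in `n` variables that treats the variables
as independent (`momentFunctional_vandermondePoly_sq`). For moments `C₁ μ₁ + C₂ μ₂` this value
splits according to the number `r` of variables that carry `μ₁` (`det_hankel_add`), which gives the
amplitude of each exponential. The variables carrying `Ai` and those carrying `Bi` are then
recentred at the two saddle points `±(x / 2) ^ (1 / 2)`, `x = -z`, and rescaled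
(`mixedHankel_eq`). In these variables the squared Vandermonde polynomial is the product of a
polynomial homogeneous in the displacements and an interaction factor with constant term
`4 ^ (r (n - r))` (`saddlePoly_eq`). Hence the formal expansion starts at order
`r (r - 1) / 2 + (n - r) (n - r - 1) / 2` in `x ^ (-3 / 2)`, and its leading coefficient is a product
of two Gaussian Hankel determinants (`coeff_hankelSeries`). These are products of factorials by the
orthogonality of the Hermite polynomials (`det_gaussMoment`).
-/

noncomputable section

/-! ### The Airy kernel on vertical lines -/

/-- The integrand `t ^ k * exp (t ^ 3 / 3 - y * t)` of the `k`-th moment of the Airy contour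
integral. -/
def airyKernel (k : ℕ) (y t : ℂ) : ℂ := t ^ k * Complex.exp (t ^ 3 / 3 - y * t)

theorem differentiable_airyKernel (k : ℕ) (y : ℂ) : Differentiable ℂ (airyKernel k y) := by
  unfold airyKernel; fun_prop

theorem norm_airyKernel_le (k : ℕ) (y : ℂ) (a s : ℝ) (ha : 0 ≤ a) :
    ‖airyKernel k y (a + s * Complex.I)‖ ≤
      k.factorial * Real.exp (a ^ 3 / 3 - a * s ^ 2 + (‖y‖ + 1) * (a + |s|)) := by
  have h1 : ‖(a + s * Complex.I : ℂ)‖ ≤ a + |s| := by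
    refine (norm_add_le _ _).trans ?_
    simp [abs_of_nonneg ha]
  have h2 : ‖(a + s * Complex.I : ℂ)‖ ^ k ≤ k.factorial * Real.exp (a + |s|) := by
    have := Real.pow_div_factorial_le_exp (a + |s|) (by positivity) k
    rw [div_le_iff₀ (by positivity)] at this
    calc _ ≤ (a + |s|) ^ k := by gcongr
      _ ≤ _ := by linarith
  have h3 : ((a + s * Complex.I : ℂ) ^ 3 / 3 - y * (a + s * Complex.I)).re ≤
      a ^ 3 / 3 - a * s ^ 2 + ‖y‖ * (a + |s|) := by
    have h4 : -(y * (a + s * Complex.I)).re ≤ ‖y‖ * (a + |s|) := by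
      refine (neg_le_abs _).trans ((Complex.abs_re_le_norm _).trans ?_)
      rw [norm_mul]; gcongr
    have h5 : ((a + s * Complex.I : ℂ) ^ 3 / 3).re = a ^ 3 / 3 - a * s ^ 2 := by
      have : (a + s * Complex.I : ℂ) ^ 3 / 3 =
          ((a ^ 3 / 3 - a * s ^ 2 : ℝ) : ℂ) + ((a ^ 2 * s - s ^ 3 / 3 : ℝ) : ℂ) * Complex.I := by
        push_cast
        linear_combination (↑a * ↑s ^ 2 + ↑s ^ 3 * Complex.I / 3) * Complex.I_sq
      rw [this, Complex.add_re, Complex.ofReal_re, Complex.re_ofReal_mul]; simp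
    rw [Complex.sub_re, h5]; linarith
  rw [airyKernel, norm_mul, norm_pow, Complex.norm_exp]
  calc _ ≤ (k.factorial * Real.exp (a + |s|)) *
        Real.exp (a ^ 3 / 3 - a * s ^ 2 + ‖y‖ * (a + |s|)) := by gcongr
    _ = _ := by rw [mul_assoc, ← Real.exp_add]; congr 2; ring

/-- A Gaussian bound on a vertical line, uniform for `y` in a bounded set. -/
theorem exists_norm_airyKernel_le (k : ℕ) (R a : ℝ) (ha : 0 < a) :
    ∃ C : ℝ, ∀ y : ℂ, ‖y‖ ≤ R → ∀ s : ℝ,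
      ‖airyKernel k y (a + s * Complex.I)‖ ≤ C * Real.exp (-(a / 2) * s ^ 2) := by
  refine ⟨k.factorial * Real.exp (a ^ 3 / 3 + (R + 1) * a + (R + 1) ^ 2 / (2 * a)), ?_⟩
  intro y hy s
  refine (norm_airyKernel_le k y a s ha.le).trans ?_
  rw [mul_assoc, ← Real.exp_add]
  refine mul_le_mul_of_nonneg_left (Real.exp_le_exp.2 ?_) (by positivity)
  have hR : (‖y‖ + 1) * (a + |s|) ≤ (R + 1) * (a + |s|) := by gcongr
  have : (R + 1) * |s| ≤ (R + 1) ^ 2 / (2 * a) + a / 2 * s ^ 2 := by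
    have h : (R + 1) ^ 2 / (2 * a) + a / 2 * s ^ 2 - (R + 1) * |s| =
      (R + 1 - a * |s|) ^ 2 / (2 * a) := by
      rw [← sq_abs s]; field_simp; ring
    have : 0 ≤ (R + 1 - a * |s|) ^ 2 / (2 * a) := by positivity
    linarith
  nlinarith

theorem continuous_airyKernel_line (k : ℕ) (y : ℂ) (a : ℝ) :
    Continuous fun s : ℝ => airyKernel k y (a + s * Complex.I) :=
  (differentiable_airyKernel k y).continuous.comp (by fun_prop)

theorem integrable_airyKernel_line (k : ℕ) (y : ℂ) {a : ℝ} (ha : 0 < a) :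
    MeasureTheory.Integrable fun s : ℝ => airyKernel k y (a + s * Complex.I) := by
  obtain ⟨C, hC⟩ := exists_norm_airyKernel_le k ‖y‖ a ha
  refine MeasureTheory.Integrable.mono' (g := fun s => C * Real.exp (-(a / 2) * s ^ 2))
    ((integrable_exp_neg_mul_sq (by positivity)).const_mul C)
    (continuous_airyKernel_line k y a).aestronglyMeasurable ?_
  exact Eventually.of_forall fun s => hC y le_rfl s

/-- The moment `∫ t ^ k * exp (t ^ 3 / 3 - y * t)` over the line `t = a + i s`. -/
def airyLine (k : ℕ) (a : ℝ) (y : ℂ) : ℂ :=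
  ∫ s : ℝ, airyKernel k y (a + s * Complex.I)

theorem hasDerivAt_airyLine (k : ℕ) {a : ℝ} (ha : 0 < a) (y : ℂ) :
    HasDerivAt (airyLine k a) (-airyLine (k + 1) a y) y := by
  obtain ⟨C, hC⟩ := exists_norm_airyKernel_le (k + 1) (‖y‖ + 1) a ha
  have := (hasDerivAt_integral_of_dominated_loc_of_deriv_le
    (F := fun (y : ℂ) (s : ℝ) => airyKernel k y (a + s * Complex.I))
    (F' := fun (y : ℂ) (s : ℝ) => -airyKernel (k + 1) y (a + s * Complex.I))
    (x₀ := y) (s := Metric.ball y 1) (μ := MeasureTheory.volume)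
    (bound := fun s => C * Real.exp (-(a / 2) * s ^ 2))
    (Metric.ball_mem_nhds y one_pos)
    (Eventually.of_forall fun w => (continuous_airyKernel_line k w a).aestronglyMeasurable)
    (integrable_airyKernel_line k y ha)
    (continuous_airyKernel_line (k + 1) y a).neg.aestronglyMeasurable
    (Eventually.of_forall fun s w hw => ?_)
    ((integrable_exp_neg_mul_sq (by positivity)).const_mul C)
    (Eventually.of_forall fun s w hw => ?_)).2
  · rw [MeasureTheory.integral_neg] at this
    exact this
  · rw [norm_neg]
    refine hC w ?_ s
    have h1 : ‖w - y‖ < 1 := by simpa [dist_eq_norm] using hw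
    have := norm_le_norm_add_norm_sub' w y
    linarith
  · set t : ℂ := a + s * Complex.I
    have h : HasDerivAt (fun w : ℂ => t ^ 3 / 3 - w * t) (-t) w := by
      simpa using ((hasDerivAt_id w).mul_const t).const_sub (t ^ 3 / 3)
    have h' := (h.cexp).const_mul (t ^ k)
    unfold airyKernel
    exact h'.congr_deriv (by ring)

/-- Along paths that stay in the sector `a ≤ Re t ≤ |Im t| / √3`, where the kernel decays,
a primitive of the kernel has the same limit on both paths. -/
theorem tendsto_primitive_sub (k : ℕ) (y : ℂ) {Φ : ℂ → ℂ}
    (hΦ : ∀ t, HasDerivAt Φ (airyKernel k y t) t) {a : ℝ} (ha : 0 < a)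
    {ι : Type*} {l : Filter ι} {h p q : ι → ℝ} (hh : Tendsto (fun i => |h i|) l atTop)
    (hp : ∀ᶠ i in l, a ≤ p i ∧ 3 * p i ^ 2 ≤ h i ^ 2)
    (hq : ∀ᶠ i in l, a ≤ q i ∧ 3 * q i ^ 2 ≤ h i ^ 2) :
    Tendsto (fun i => Φ (p i + h i * Complex.I) - Φ (q i + h i * Complex.I)) l (nhds 0) := by
  set B : ℝ := 2 * (‖y‖ + 1) + 1
  have hlim : Tendsto (fun i => k.factorial *
      Real.exp (-((8 / 9 * a * |h i| - B) * |h i|))) l (nhds 0) := by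
    rw [← mul_zero (k.factorial : ℝ)]
    refine Tendsto.const_mul _ (Real.tendsto_exp_neg_atTop_nhds_zero.comp ?_)
    refine Tendsto.atTop_mul_atTop₀ ?_ hh
    exact tendsto_atTop_add_const_right _ _ (hh.const_mul_atTop (by positivity))
  refine squeeze_zero_norm' ?_ hlim
  filter_upwards [hp, hq] with i hpi hqi
  set H : ℝ := |h i|
  have hH : 0 ≤ H := abs_nonneg _
  have hle : ∀ x : ℝ, a ≤ x → 3 * x ^ 2 ≤ h i ^ 2 → x ≤ H := fun x hx1 hx2 => by
    refine abs_le_of_sq_le_sq' (by rw [sq_abs]; nlinarith) hH |>.2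
  -- On the horizontal segment at height `h i` inside the sector, the real part of the phase is at
  -- most `-(8 / 9) a H ^ 2 + O(H)`, which beats the length of the segment.
  have hconv : Convex ℝ {t : ℂ | ∃ x : ℝ, (a ≤ x ∧ x ≤ H ∧ 3 * x ^ 2 ≤ h i ^ 2) ∧
      t = x + h i * Complex.I} := by
    rintro _ ⟨x, ⟨hx1, hx2, hx3⟩, rfl⟩ _ ⟨x', ⟨hx1', hx2', hx3'⟩, rfl⟩ u v hu hv huv
    refine ⟨u * x + v * x', ⟨by nlinarith, by nlinarith, ?_⟩, ?_⟩
    · have h1 : (u * x + v * x') ^ 2 ≤ u * x ^ 2 + v * x' ^ 2 := by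
        have : v = 1 - u := by linarith
        subst this
        nlinarith [mul_nonneg (mul_nonneg hu hv) (sq_nonneg (x - x'))]
      nlinarith
    · have : (u : ℂ) + v = 1 := by exact_mod_cast huv
      simp only [Complex.real_smul]; push_cast
      linear_combination (h i * Complex.I : ℂ) * this
  have := hconv.norm_image_sub_le_of_norm_hasDerivWithin_le (f := Φ) (f' := airyKernel k y)
    (C := k.factorial * Real.exp (-(8 / 9 * a * H ^ 2) + 2 * (‖y‖ + 1) * H))
    (fun t _ => (hΦ t).hasDerivWithinAt) ?_
    ⟨q i, ⟨hqi.1, hle _ hqi.1 hqi.2, hqi.2⟩, rfl⟩ ⟨p i, ⟨hpi.1, hle _ hpi.1 hpi.2, hpi.2⟩, rfl⟩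
  · refine this.trans ?_
    have h1 : ‖(p i + h i * Complex.I : ℂ) - (q i + h i * Complex.I)‖ ≤ Real.exp H := by
      have : (p i + h i * Complex.I : ℂ) - (q i + h i * Complex.I) = ((p i - q i : ℝ) : ℂ) := by
        push_cast; ring
      rw [this, Complex.norm_real, Real.norm_eq_abs]
      have h2 : |p i - q i| ≤ H := by
        rw [abs_le]; constructor <;> linarith [hle _ hpi.1 hpi.2, hle _ hqi.1 hqi.2, hpi.1, hqi.1]
      linarith [Real.add_one_le_exp H]
    calc _ ≤ k.factorial * Real.exp (-(8 / 9 * a * H ^ 2) + 2 * (‖y‖ + 1) * H) * Real.exp H := by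
          gcongr
      _ = _ := by rw [mul_assoc, ← Real.exp_add]; congr 2; ring
  · rintro _ ⟨x, ⟨hx1, hx2, hx3⟩, rfl⟩
    refine (norm_airyKernel_le k y x (h i) (by linarith)).trans ?_
    refine mul_le_mul_of_nonneg_left (Real.exp_le_exp.2 ?_) (by positivity)
    have h1 : h i ^ 2 = H ^ 2 := (sq_abs _).symm
    rw [h1] at hx3 ⊢
    have h2 : x ^ 3 / 3 ≤ x * H ^ 2 / 9 := by nlinarith
    have h3 : a * H ^ 2 ≤ x * H ^ 2 := by gcongr
    have h4 : (‖y‖ + 1) * (x + |h i|) ≤ (‖y‖ + 1) * (2 * H) :=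
      mul_le_mul_of_nonneg_left (by linarith) (by positivity)
    linarith [show |h i| = H from rfl]

theorem hasDerivAt_comp_line {Φ φ : ℂ → ℂ} (hΦ : ∀ t, HasDerivAt Φ (φ t) t) (b ω : ℂ) (s : ℝ) :
    HasDerivAt (fun s : ℝ => Φ (b + s * ω)) (φ (b + s * ω) * ω) s := by
  have h1 : HasDerivAt (fun s : ℝ => b + (s : ℂ) * ω) ω s := by
    simpa using ((Complex.ofRealCLM.hasDerivAt (x := s)).mul_const ω).const_add b
  exact (hΦ _).comp s h1

/-- The line integral is the limit of increments of a primitive. -/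
theorem tendsto_airyLine (k : ℕ) (y : ℂ) {Φ : ℂ → ℂ}
    (hΦ : ∀ t, HasDerivAt Φ (airyKernel k y t) t) {a : ℝ} (ha : 0 < a)
    {h : ℝ → ℝ} (hh : Tendsto h atTop atTop) :
    Tendsto (fun R => Φ (a + h R * Complex.I) - Φ (a + (-h R : ℝ) * Complex.I)) atTop
      (nhds (airyLine k a y * Complex.I)) := by
  have h1 := (MeasureTheory.intervalIntegral_tendsto_integral
    ((integrable_airyKernel_line k y ha).mul_const Complex.I)
    (tendsto_neg_atTop_atBot.comp hh) hh)
  rw [MeasureTheory.integral_mul_const] at h1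
  refine h1.congr fun R => ?_
  exact intervalIntegral.integral_eq_sub_of_hasDerivAt
    (fun s _ => hasDerivAt_comp_line hΦ a Complex.I s)
    (((continuous_airyKernel_line k y a).mul continuous_const).intervalIntegrable _ _)

theorem exists_primitive_airyKernel (k : ℕ) (y : ℂ) :
    ∃ Φ : ℂ → ℂ, ∀ t, HasDerivAt Φ (airyKernel k y t) t := by
  obtain ⟨Φ, hΦ⟩ := (differentiable_airyKernel k y).isExactOn_univ
  exact ⟨Φ, fun t => hΦ t (Set.mem_univ t)⟩

/-- The ray integrand is integrable along directions with `ω ^ 3 = -1`. -/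
theorem integrableOn_airyKernel_ray (y : ℂ) {ω : ℂ} (hω : ω ^ 3 = -1) :
    MeasureTheory.IntegrableOn (fun s : ℝ => airyKernel 0 y (s * ω)) (Set.Ioi 0) := by
  have hcont : Continuous fun s : ℝ => airyKernel 0 y (s * ω) :=
    (differentiable_airyKernel 0 y).continuous.comp (by fun_prop)
  set B : ℝ := ‖y * ω‖ + 1
  have hB : 0 < B := by positivity
  refine MeasureTheory.Integrable.mono' (g := fun s : ℝ => Real.exp (B * (3 * B)) * Real.exp (-s))
    ((integrableOn_exp_neg_Ioi 0).const_mul _) hcont.aestronglyMeasurable ?_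
  refine (MeasureTheory.ae_restrict_iff' measurableSet_Ioi).2 (Eventually.of_forall ?_)
  intro s (hs : 0 < s)
  rw [airyKernel, pow_zero, one_mul, Complex.norm_exp, ← Real.exp_add]
  gcongr
  have h1 : ((s * ω : ℂ) ^ 3 / 3 - y * (s * ω)) = ((-(s ^ 3 / 3) : ℝ) : ℂ) - s * (y * ω) := by
    rw [mul_pow, hω]; push_cast; ring
  have h2 : -((s * (y * ω) : ℂ)).re ≤ s * ‖y * ω‖ := by
    refine (neg_le_abs _).trans ((Complex.abs_re_le_norm _).trans ?_)
    rw [norm_mul, Complex.norm_real, Real.norm_of_nonneg hs.le]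
  rw [h1, Complex.sub_re, Complex.ofReal_re]
  have h3 : s * B ≤ s ^ 3 / 3 + B * (3 * B) := by
    rcases le_total s (3 * B) with h | h
    · nlinarith [pow_pos hs 3]
    · have hB1 : 1 ≤ B := by
        simp only [B]; linarith [norm_nonneg (y * ω)]
      have : 3 * B ≤ s ^ 2 := by nlinarith
      nlinarith
  have : s * B = s * ‖y * ω‖ + s := by simp only [B]; ring
  linarith

theorem tendsto_airyRay (y : ℂ) {Φ : ℂ → ℂ} (hΦ : ∀ t, HasDerivAt Φ (airyKernel 0 y t) t)
    {ω : ℂ} (hω : ω ^ 3 = -1) :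
    Tendsto (fun R : ℝ => Φ (R * ω) - Φ 0) atTop (nhds (airyRay ω y)) := by
  have h1 := MeasureTheory.intervalIntegral_tendsto_integral_Ioi 0
    ((integrableOn_airyKernel_ray y hω).mul_const ω) tendsto_id
  rw [MeasureTheory.integral_mul_const] at h1
  have h2 : (∫ s : ℝ in Set.Ioi 0, airyKernel 0 y (s * ω)) * ω = airyRay ω y := by
    rw [airyRay, mul_comm]
    simp only [airyKernel, pow_zero, one_mul, mul_comm ω]
  rw [← h2]
  refine h1.congr fun R => ?_
  have hcont : Continuous fun s : ℝ => airyKernel 0 y (s * ω) :=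
    (differentiable_airyKernel 0 y).continuous.comp (by fun_prop)
  have := intervalIntegral.integral_eq_sub_of_hasDerivAt (a := 0) (b := R)
    (fun s _ => hasDerivAt_comp_line hΦ 0 ω s)
    (by simpa using (hcont.mul_const ω).intervalIntegrable _ _)
  simpa using this

theorem airyDir_eq : airyDir = (1 / 2 : ℝ) + (√3 / 2 : ℝ) * Complex.I := by
  rw [airyDir, show (Real.pi : ℂ) * Complex.I / 3 = ((Real.pi / 3 : ℝ) : ℂ) * Complex.I by
    push_cast; ring, Complex.exp_mul_I, ← Complex.ofReal_cos, ← Complex.ofReal_sin,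
    Real.cos_pi_div_three, Real.sin_pi_div_three]

theorem airyDir'_eq : airyDir' = (1 / 2 : ℝ) + (-(√3 / 2) : ℝ) * Complex.I := by
  rw [airyDir', show -((Real.pi : ℂ) * Complex.I / 3) = ((-(Real.pi / 3) : ℝ) : ℂ) * Complex.I by
    push_cast; ring, Complex.exp_mul_I, ← Complex.ofReal_cos, ← Complex.ofReal_sin,
    Real.cos_neg, Real.sin_neg, Real.cos_pi_div_three, Real.sin_pi_div_three]

theorem airyDir_pow_three : airyDir ^ 3 = -1 := by
  rw [airyDir, ← Complex.exp_nat_mul, ← Complex.exp_pi_mul_I]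
  congr 1; push_cast; ring

theorem airyDir'_pow_three : airyDir' ^ 3 = -1 := by
  rw [airyDir', ← Complex.exp_nat_mul, ← Complex.exp_neg_pi_mul_I]
  congr 1; push_cast; ring

/-- The contour of `airyAi` can be straightened to a vertical line. -/
theorem airyAi_eq_airyLine (y : ℂ) {a : ℝ} (ha : 0 < a) :
    airyAi y = 1 / (2 * Real.pi) * airyLine 0 a y := by
  obtain ⟨Φ, hΦ⟩ := exists_primitive_airyKernel 0 y
  have h3 : (0 : ℝ) < √3 / 2 := by positivity
  have hs : Tendsto (fun R : ℝ => R * (√3 / 2)) atTop atTop :=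
    tendsto_id.atTop_mul_const h3
  have hsq : √3 ^ 2 = 3 := Real.sq_sqrt (by norm_num)
  have h1 := tendsto_airyLine 0 y hΦ ha hs
  have hr := (tendsto_airyRay y hΦ airyDir_pow_three).sub (tendsto_airyRay y hΦ airyDir'_pow_three)
  -- The rays run along the boundary `|Im t| = √3 Re t` of the sector.
  have hev : ∀ᶠ R : ℝ in atTop, a ≤ R * (1 / 2) ∧ 3 * (R * (1 / 2)) ^ 2 ≤ (R * (√3 / 2)) ^ 2 := by
    filter_upwards [eventually_ge_atTop (2 * a)] with R hR
    refine ⟨by linarith, le_of_eq ?_⟩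
    linear_combination (-R ^ 2 / 4) * hsq
  have hev' : ∀ᶠ R : ℝ in atTop, a ≤ a ∧ 3 * a ^ 2 ≤ (R * (√3 / 2)) ^ 2 :=
    (((tendsto_pow_atTop two_ne_zero).comp hs).eventually_ge_atTop _).mono fun R h => ⟨le_rfl, h⟩
  have hu := tendsto_primitive_sub 0 y hΦ ha (h := fun R : ℝ => R * (√3 / 2))
    (tendsto_abs_atTop_atTop.comp hs) hev hev'
  have hl := tendsto_primitive_sub 0 y hΦ ha (h := fun R : ℝ => -(R * (√3 / 2)))
    ((tendsto_abs_atTop_atTop.comp hs).congr fun R => (abs_neg _).symm)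
    (hev.mono fun R h => ⟨h.1, h.2.trans_eq (neg_sq _).symm⟩)
    (hev'.mono fun R h => ⟨h.1, h.2.trans_eq (neg_sq _).symm⟩)
  have h4 := tendsto_nhds_unique ((hr.sub h1).congr fun R => by
    rw [airyDir_eq, airyDir'_eq]
    have e1 : (R : ℂ) * (((1 / 2 : ℝ) : ℂ) + ((√3 / 2 : ℝ) : ℂ) * Complex.I) =
      ((R * (1 / 2) : ℝ) : ℂ) + ((R * (√3 / 2) : ℝ) : ℂ) * Complex.I := by push_cast; ring
    have e2 : (R : ℂ) * (((1 / 2 : ℝ) : ℂ) + ((-(√3 / 2) : ℝ) : ℂ) * Complex.I) =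
      ((R * (1 / 2) : ℝ) : ℂ) + ((-(R * (√3 / 2)) : ℝ) : ℂ) * Complex.I := by push_cast; ring
    rw [e1, e2]
    show _ = (Φ _ - Φ _) - (Φ _ - Φ _)
    ring) (hu.sub hl)
  rw [sub_zero, sub_eq_zero] at h4
  rw [airyAi, h4]
  have := Complex.I_ne_zero
  have : (Real.pi : ℂ) ≠ 0 := by exact_mod_cast Real.pi_ne_zero
  field_simp

theorem iteratedDeriv_airyAi (k : ℕ) {a : ℝ} (ha : 0 < a) (y : ℂ) :
    iteratedDeriv k airyAi y = (-1) ^ k / (2 * Real.pi) * airyLine k a y := by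
  induction k generalizing y with
  | zero => simp [airyAi_eq_airyLine y ha]
  | succ k ih =>
    rw [iteratedDeriv_succ, show iteratedDeriv k airyAi = _ from funext ih]
    rw [((hasDerivAt_airyLine k ha y).const_mul _).deriv]
    ring

theorem contDiff_airyAi : ContDiff ℂ ⊤ airyAi := by
  have h : Differentiable ℂ airyAi := fun y => by
    rw [show airyAi = _ from funext fun y => airyAi_eq_airyLine y one_pos]
    exact ((hasDerivAt_airyLine 0 one_pos y).const_mul _).differentiableAt
  exact h.contDiff

/-- Shifting the integration line horizontally to the complex abscissa `w`. -/
theorem iteratedDeriv_airyAi_eq_integral (k : ℕ) (y : ℂ) {w : ℂ} (hw : 0 < w.re) :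
    iteratedDeriv k airyAi y =
      (-1) ^ k / (2 * Real.pi) * ∫ s : ℝ, airyKernel k y (w + s * Complex.I) := by
  rw [iteratedDeriv_airyAi k hw, airyLine]
  congr 1
  rw [← MeasureTheory.integral_add_right_eq_self _ w.im]
  congr 1
  funext s
  congr 1
  apply Complex.ext <;> simp
  ring

/-! ### Expansion of the normalized moments about a saddle point -/

/-- The moments of the standard Gaussian. -/
def gaussMoment : ℕ → ℕ
  | 0 => 1
  | 1 => 0
  | m + 2 => (m + 1) * gaussMoment m

theorem gaussMoment_odd (q : ℕ) : gaussMoment (2 * q + 1) = 0 := by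
  induction q with
  | zero => rfl
  | succ q ih => rw [show 2 * (q + 1) + 1 = (2 * q + 1) + 2 by ring, gaussMoment, ih, mul_zero]

theorem integrable_abs_pow_mul_exp (m : ℕ) {b : ℝ} (hb : 0 < b) :
    MeasureTheory.Integrable fun s : ℝ => |s| ^ m * Real.exp (-b * s ^ 2) := by
  have h := (integrable_rpow_mul_exp_neg_mul_sq hb (s := m)
    (by have : (0 : ℝ) ≤ m := m.cast_nonneg
        linarith)).norm
  refine h.congr (Eventually.of_forall fun s => ?_)
  simp [Real.rpow_natCast, abs_of_pos (Real.exp_pos _)]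

theorem norm_exp_neg_mul_sq (b : ℂ) (s : ℝ) :
    ‖Complex.exp (-b * (s : ℂ) ^ 2)‖ = Real.exp (-b.re * s ^ 2) := by
  rw [Complex.norm_exp, ← Complex.ofReal_pow, Complex.re_mul_ofReal, Complex.neg_re]

theorem integrable_pow_mul_cexp (m : ℕ) {b : ℂ} (hb : 0 < b.re) :
    MeasureTheory.Integrable fun s : ℝ => (s : ℂ) ^ m * Complex.exp (-b * (s : ℂ) ^ 2) := by
  refine (integrable_abs_pow_mul_exp m hb).mono' (by fun_prop) (Eventually.of_forall fun s => ?_)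
  rw [norm_mul, norm_exp_neg_mul_sq, norm_pow, Complex.norm_real, Real.norm_eq_abs]

theorem hasDerivAt_cexp_neg_mul_sq (b : ℂ) (s : ℝ) :
    HasDerivAt (fun s : ℝ => Complex.exp (-b * (s : ℂ) ^ 2))
      (-2 * b * (s * Complex.exp (-b * (s : ℂ) ^ 2))) s := by
  have h : HasDerivAt (fun t : ℂ => Complex.exp (-b * t ^ 2))
      (Complex.exp (-b * (s : ℂ) ^ 2) * (-b * (2 * s))) (s : ℂ) := by
    simpa using ((hasDerivAt_pow 2 (s : ℂ)).const_mul (-b)).cexp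
  exact h.comp_ofReal.congr_deriv (by ring)

theorem integral_pow_add_two_mul_cexp (m : ℕ) {b : ℂ} (hb : 0 < b.re) :
    ∫ s : ℝ, (s : ℂ) ^ (m + 2) * Complex.exp (-b * (s : ℂ) ^ 2) =
      (m + 1) / (2 * b) * ∫ s : ℝ, (s : ℂ) ^ m * Complex.exp (-b * (s : ℂ) ^ 2) := by
  have hb0 : b ≠ 0 := fun h => by simp [h] at hb
  have hderiv : ∀ s : ℝ, HasDerivAt
      (fun s : ℝ => (s : ℂ) ^ (m + 1) * Complex.exp (-b * (s : ℂ) ^ 2))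
      ((m + 1) * ((s : ℂ) ^ m * Complex.exp (-b * (s : ℂ) ^ 2)) -
        2 * b * ((s : ℂ) ^ (m + 2) * Complex.exp (-b * (s : ℂ) ^ 2))) s := fun s => by
    have h1 : HasDerivAt (fun s : ℝ => (s : ℂ) ^ (m + 1)) ((m + 1) * (s : ℂ) ^ m) s := by
      simpa using (hasDerivAt_pow (m + 1) (s : ℂ)).comp_ofReal
    exact (h1.mul (hasDerivAt_cexp_neg_mul_sq b s)).congr_deriv (by ring)
  have h := MeasureTheory.integral_eq_zero_of_hasDerivAt_of_integrable hderiv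
    (((integrable_pow_mul_cexp m hb).const_mul _).sub
      ((integrable_pow_mul_cexp (m + 2) hb).const_mul _)) (integrable_pow_mul_cexp (m + 1) hb)
  rw [MeasureTheory.integral_sub ((integrable_pow_mul_cexp m hb).const_mul _)
      ((integrable_pow_mul_cexp (m + 2) hb).const_mul _),
    MeasureTheory.integral_const_mul, MeasureTheory.integral_const_mul, sub_eq_zero] at h
  rw [div_mul_eq_mul_div, eq_div_iff (by simpa using hb0)]
  linear_combination -h

theorem integral_pow_mul_gaussian {v : ℂ} (hv : 0 < v.re) (hv2 : 0 < (v ^ 2).re) (m : ℕ) :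
    ∫ s : ℝ, (s : ℂ) ^ m * Complex.exp (-v ^ 2 * (s : ℂ) ^ 2) =
      (√Real.pi : ℂ) / v * gaussMoment m / ((√2 : ℂ) * v) ^ m := by
  have hv0 : v ≠ 0 := fun h => by simp [h] at hv
  have h2 : (√2 : ℂ) ^ 2 = 2 := by exact_mod_cast Real.sq_sqrt (by norm_num : (0 : ℝ) ≤ 2)
  have h20 : (√2 : ℂ) ≠ 0 := fun h => by simp [h] at h2
  induction m using Nat.twoStepInduction with
  | zero =>
    have hpi : (√Real.pi : ℂ) ^ 2 = Real.pi := by exact_mod_cast Real.sq_sqrt Real.pi_pos.le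
    have hre : 0 < ((√Real.pi : ℂ) / v).re := by
      rw [Complex.div_re]
      have : 0 < Complex.normSq v := Complex.normSq_pos.2 hv0
      simp only [Complex.ofReal_re, Complex.ofReal_im, zero_mul, zero_div, add_zero]
      positivity
    have := integral_gaussian_complex hv2
    rw [show (Real.pi : ℂ) / v ^ 2 = ((√Real.pi : ℂ) / v) ^ 2 by rw [div_pow, hpi],
      one_div, Complex.sq_cpow_two_inv hre] at this
    simpa [gaussMoment] using this
  | one =>
    have hi := (integrable_pow_mul_cexp 1 hv2)
    simp only [pow_one] at hi
    have h := MeasureTheory.integral_eq_zero_of_hasDerivAt_of_integrable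
      (hasDerivAt_cexp_neg_mul_sq (v ^ 2)) (hi.const_mul _)
      (by simpa using integrable_pow_mul_cexp 0 hv2)
    rw [MeasureTheory.integral_const_mul] at h
    have : (-2 * v ^ 2 : ℂ) ≠ 0 := by simp [hv0]
    simpa [gaussMoment, hv0] using h
  | more m ih _ =>
    rw [integral_pow_add_two_mul_cexp m hv2, ih, gaussMoment, pow_add, mul_pow _ _ 2, h2]
    push_cast
    field_simp

/-- Taylor's theorem for `exp (i θ)`, with a remainder that is uniform on the whole real line. -/
theorem exists_norm_exp_sub_sum_le (L : ℕ) :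
    ∃ C : ℝ, 0 ≤ C ∧ ∀ z : ℂ, z.re = 0 →
      ‖Complex.exp z - ∑ l ∈ Finset.range L, z ^ l / l.factorial‖ ≤ C * ‖z‖ ^ L := by
  refine ⟨Real.exp 1 + (1 + L), by positivity, fun z hz => ?_⟩
  rcases le_total ‖z‖ 1 with h | h
  · refine (Complex.norm_exp_sub_sum_le_norm_mul_exp z L).trans ?_
    rw [mul_comm]
    gcongr
    have := Real.exp_le_exp.2 h
    have : (0 : ℝ) ≤ L := L.cast_nonneg
    linarith
  · refine (norm_sub_le _ _).trans ?_
    have h1 : ‖Complex.exp z‖ ≤ ‖z‖ ^ L := by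
      rw [Complex.norm_exp, hz, Real.exp_zero]; exact one_le_pow₀ h
    have h2 : ‖∑ l ∈ Finset.range L, z ^ l / l.factorial‖ ≤ L * ‖z‖ ^ L := by
      refine (norm_sum_le_of_le (f := fun l => z ^ l / (l.factorial : ℂ)) (Finset.range L)
        (n := fun _ => ‖z‖ ^ L) fun l hl => ?_).trans (by simp)
      rw [norm_div, norm_pow, Complex.norm_natCast]
      refine (div_le_self (by positivity) (by exact_mod_cast l.factorial_pos)).trans ?_
      exact pow_le_pow_right₀ h (Finset.mem_range.1 hl).le
    have : 0 ≤ Real.exp 1 * ‖z‖ ^ L := by positivity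
    linarith

/-- The `m`-th moment of `(t - v ^ 2) / v ^ 2` against the Airy kernel with parameter `y = v ^ 4`,
on the vertical line through the saddle point `t = v ^ 2`, normalized so that the zeroth moment
tends to `1`. -/
def saddleMoment (m : ℕ) (v : ℂ) : ℂ :=
  v / √Real.pi * ∫ s : ℝ, (Complex.I * s / v ^ 2) ^ m *
    (Complex.exp (-v ^ 2 * (s : ℂ) ^ 2) * Complex.exp (-(Complex.I * (s : ℂ) ^ 3 / 3)))

/-- The coefficient of `v ^ (-3 * i)` in the expansion of `saddleMoment m v`. -/
def saddleTerm (m i : ℕ) : ℂ :=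
  if i < m then 0 else
    Complex.I ^ m * ((-(Complex.I / 3)) ^ (i - m) / (i - m).factorial) *
      gaussMoment (3 * i - 2 * m) / (√2 : ℂ) ^ (3 * i - 2 * m)

/-- The coefficient of `v ^ (-6 * j)` in the expansion of `saddleMoment m v`. -/
def saddleCoeff (m j : ℕ) : ℂ := saddleTerm m (2 * j)

theorem saddleTerm_odd (m j : ℕ) : saddleTerm m (2 * j + 1) = 0 := by
  rw [saddleTerm]
  split_ifs with h
  · rfl
  · rw [show 3 * (2 * j + 1) - 2 * m = 2 * (3 * j + 1 - m) + 1 by omega, gaussMoment_odd]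
    simp

theorem saddleCoeff_of_lt {m j : ℕ} (h : 2 * j < m) : saddleCoeff m j = 0 := if_pos h

theorem saddleCoeff_two_mul (q : ℕ) :
    saddleCoeff (2 * q) q = (-(1 / 2)) ^ q * gaussMoment (2 * q) := by
  have h2 : (√2 : ℂ) ^ 2 = 2 := by exact_mod_cast Real.sq_sqrt (by norm_num : (0 : ℝ) ≤ 2)
  rw [saddleCoeff, saddleTerm, if_neg (lt_irrefl _), show 3 * (2 * q) - 2 * (2 * q) = 2 * q by omega,
    pow_mul, pow_mul, h2, Complex.I_sq]
  rw [neg_pow (1 / 2 : ℂ), one_div, inv_pow]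
  simp
  ring

theorem sum_range_saddleTerm (m N : ℕ) (u : ℂ) :
    ∑ i ∈ Finset.range (2 * N), saddleTerm m i * u ^ i =
      ∑ j ∈ Finset.range N, saddleCoeff m j * (u ^ 2) ^ j := by
  induction N with
  | zero => simp
  | succ N ih =>
    rw [show 2 * (N + 1) = 2 * N + 1 + 1 by ring, Finset.sum_range_succ, Finset.sum_range_succ, ih,
      Finset.sum_range_succ, saddleTerm_odd, zero_mul, add_zero, ← pow_mul, saddleCoeff]

theorem integrable_saddle (m : ℕ) {v : ℂ} (hv2 : 0 < (v ^ 2).re) :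
    MeasureTheory.Integrable fun s : ℝ => (Complex.I * s / v ^ 2) ^ m *
    (Complex.exp (-v ^ 2 * (s : ℂ) ^ 2) * Complex.exp (-(Complex.I * (s : ℂ) ^ 3 / 3))) := by
  refine ((integrable_abs_pow_mul_exp m hv2).const_mul (‖v ^ 2‖⁻¹ ^ m)).mono' (by fun_prop)
    (Eventually.of_forall fun s => le_of_eq ?_)
  have h : (-(Complex.I * (s : ℂ) ^ 3 / 3)).re = 0 := by
    rw [show -(Complex.I * (s : ℂ) ^ 3 / 3) = ((-(s ^ 3 / 3) : ℝ) : ℂ) * Complex.I by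
      push_cast; ring, Complex.re_ofReal_mul]
    simp
  rw [norm_mul, norm_mul, norm_exp_neg_mul_sq, norm_pow, norm_div, norm_mul, Complex.norm_real,
    Complex.norm_I, one_mul, Real.norm_eq_abs, Complex.norm_exp _, h, Real.exp_zero, mul_one,
    div_eq_inv_mul, mul_pow, mul_assoc]

theorem integral_abs_pow_mul_exp (m : ℕ) {b : ℝ} (hb : 0 < b) :
    ∫ s : ℝ, |s| ^ m * Real.exp (-b ^ 2 * s ^ 2) =
      (b ^ (m + 1))⁻¹ * ∫ s : ℝ, |s| ^ m * Real.exp (-s ^ 2) := by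
  have h := MeasureTheory.Measure.integral_comp_mul_left
    (fun s : ℝ => |s| ^ m * Real.exp (-s ^ 2)) b
  rw [abs_of_pos (inv_pos.2 hb), smul_eq_mul] at h
  rw [pow_succ b m, mul_inv, mul_assoc, ← h, ← MeasureTheory.integral_const_mul]
  congr 1
  funext s
  rw [abs_mul, abs_of_pos hb, mul_pow, mul_pow]
  field_simp

/-- The expansion of the normalized moments, truncated after `L` terms of the exponential of the
cubic term of the phase. -/
theorem exists_norm_saddleMoment_sub_le (m L : ℕ) {κ : ℝ} (hκ : 0 < κ) :
    ∃ C : ℝ, 0 ≤ C ∧ ∀ v : ℂ, 0 < v.re → κ ^ 2 * ‖v‖ ^ 2 ≤ (v ^ 2).re →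
      ‖saddleMoment m v - ∑ i ∈ Finset.range (m + L), saddleTerm m i * ((v ^ 3)⁻¹) ^ i‖ ≤
        C * ((‖v‖ ^ 3)⁻¹) ^ (m + L) := by
  obtain ⟨C, hC0, hC⟩ := exists_norm_exp_sub_sum_le L
  set G : ℝ := ∫ s : ℝ, |s| ^ (m + 3 * L) * Real.exp (-s ^ 2)
  have hG : 0 ≤ G := MeasureTheory.integral_nonneg fun s => by positivity
  refine ⟨(√Real.pi)⁻¹ * (C * (κ ^ (m + 3 * L + 1))⁻¹ * G), by positivity, fun v hv hv2 => ?_⟩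
  have hv0 : v ≠ 0 := fun h => by simp [h] at hv
  have hn : 0 < ‖v‖ := norm_pos_iff.2 hv0
  have hpos : 0 < (v ^ 2).re := lt_of_lt_of_le (by positivity) hv2
  have hpi : (√Real.pi : ℂ) ≠ 0 := by
    exact_mod_cast (Real.sqrt_pos.2 Real.pi_pos).ne'
  have h20 : (√2 : ℂ) ≠ 0 := by
    exact_mod_cast (Real.sqrt_pos.2 (by norm_num : (0 : ℝ) < 2)).ne'
  have hterm : ∀ l : ℕ, v / √Real.pi * ∫ s : ℝ, (Complex.I * s / v ^ 2) ^ m *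
      (Complex.exp (-v ^ 2 * (s : ℂ) ^ 2) * ((-(Complex.I * (s : ℂ) ^ 3 / 3)) ^ l / l.factorial)) =
      saddleTerm m (m + l) * ((v ^ 3)⁻¹) ^ (m + l) := fun l => by
    have h1 : ∀ s : ℝ, (Complex.I * s / v ^ 2) ^ m *
      (Complex.exp (-v ^ 2 * (s : ℂ) ^ 2) * ((-(Complex.I * (s : ℂ) ^ 3 / 3)) ^ l / l.factorial)) =
      (Complex.I / v ^ 2) ^ m * ((-(Complex.I / 3)) ^ l / l.factorial) *
        ((s : ℂ) ^ (m + 3 * l) * Complex.exp (-v ^ 2 * (s : ℂ) ^ 2)) := fun s => by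
      rw [show Complex.I * s / v ^ 2 = Complex.I / v ^ 2 * s by ring,
        show -(Complex.I * (s : ℂ) ^ 3 / 3) = -(Complex.I / 3) * (s : ℂ) ^ 3 by ring,
        mul_pow, mul_pow, pow_add, pow_mul]
      ring
    simp_rw [h1]
    rw [MeasureTheory.integral_const_mul, integral_pow_mul_gaussian hv hpos, saddleTerm,
      if_neg (by omega), show m + l - m = l by omega, show 3 * (m + l) - 2 * m = m + 3 * l by omega]
    have : (l.factorial : ℂ) ≠ 0 := by exact_mod_cast l.factorial_ne_zero
    simp only [div_pow, inv_pow]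
    field_simp
    ring
  have hint : ∀ l : ℕ, MeasureTheory.Integrable fun s : ℝ => (Complex.I * s / v ^ 2) ^ m *
      (Complex.exp (-v ^ 2 * (s : ℂ) ^ 2) *
        ((-(Complex.I * (s : ℂ) ^ 3 / 3)) ^ l / l.factorial)) := fun l => by
    refine ((integrable_pow_mul_cexp (m + 3 * l) hpos).const_mul
      ((Complex.I / v ^ 2) ^ m * ((-(Complex.I / 3)) ^ l / l.factorial))).congr
      (Eventually.of_forall fun s => ?_)
    simp only
    rw [show Complex.I * s / v ^ 2 = Complex.I / v ^ 2 * s by ring,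
        show -(Complex.I * (s : ℂ) ^ 3 / 3) = -(Complex.I / 3) * (s : ℂ) ^ 3 by ring,
        mul_pow, mul_pow, pow_add, pow_mul]
    ring
  have hsum : ∑ i ∈ Finset.range (m + L), saddleTerm m i * ((v ^ 3)⁻¹) ^ i =
      v / √Real.pi * ∫ s : ℝ, ∑ l ∈ Finset.range L, (Complex.I * s / v ^ 2) ^ m *
      (Complex.exp (-v ^ 2 * (s : ℂ) ^ 2) *
        ((-(Complex.I * (s : ℂ) ^ 3 / 3)) ^ l / l.factorial)) := by
    rw [MeasureTheory.integral_finsetSum _ fun l _ => hint l, Finset.mul_sum,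
      Finset.sum_range_add, Finset.sum_eq_zero, zero_add]
    · exact Finset.sum_congr rfl fun l _ => (hterm l).symm
    · intro i hi
      rw [saddleTerm, if_pos (Finset.mem_range.1 hi), zero_mul]
  rw [hsum, saddleMoment, ← mul_sub, ← MeasureTheory.integral_sub (integrable_saddle m hpos)
    (MeasureTheory.integrable_finsetSum _ fun l _ => hint l), norm_mul]
  have hbound : ∀ s : ℝ, ‖(Complex.I * s / v ^ 2) ^ m *
    (Complex.exp (-v ^ 2 * (s : ℂ) ^ 2) * Complex.exp (-(Complex.I * (s : ℂ) ^ 3 / 3))) -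
      ∑ l ∈ Finset.range L, (Complex.I * s / v ^ 2) ^ m *
      (Complex.exp (-v ^ 2 * (s : ℂ) ^ 2) *
        ((-(Complex.I * (s : ℂ) ^ 3 / 3)) ^ l / l.factorial))‖ ≤
      C * (‖v‖ ^ 2)⁻¹ ^ m * (|s| ^ (m + 3 * L) * Real.exp (-(κ * ‖v‖) ^ 2 * s ^ 2)) := fun s => by
    simp_rw [← mul_assoc]
    rw [← Finset.mul_sum, ← mul_sub, norm_mul, norm_mul, norm_exp_neg_mul_sq, norm_pow, norm_div,
      norm_mul, Complex.norm_real, Complex.norm_I, one_mul, norm_pow, Real.norm_eq_abs]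
    have hre : (-(Complex.I * (s : ℂ) ^ 3 / 3)).re = 0 := by
      rw [show -(Complex.I * (s : ℂ) ^ 3 / 3) = ((-(s ^ 3 / 3) : ℝ) : ℂ) * Complex.I by
        push_cast; ring, Complex.re_ofReal_mul]
      simp
    have hnorm : ‖(-(Complex.I * (s : ℂ) ^ 3 / 3))‖ ≤ |s| ^ 3 := by
      rw [norm_neg, norm_div, norm_mul, norm_pow, Complex.norm_I, Complex.norm_real,
        Real.norm_eq_abs, one_mul]
      exact div_le_self (by positivity) (by simp)
    have h1 : ‖Complex.exp (-(Complex.I * (s : ℂ) ^ 3 / 3)) -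
        ∑ l ∈ Finset.range L, (-(Complex.I * (s : ℂ) ^ 3 / 3)) ^ l / l.factorial‖ ≤
        C * (|s| ^ 3) ^ L := (hC _ hre).trans (by gcongr)
    have h2 : Real.exp (-(v ^ 2).re * s ^ 2) ≤ Real.exp (-(κ * ‖v‖) ^ 2 * s ^ 2) := by
      gcongr
      rw [mul_pow]; exact hv2
    calc _ ≤ (|s| / ‖v‖ ^ 2) ^ m * Real.exp (-(κ * ‖v‖) ^ 2 * s ^ 2) * (C * (|s| ^ 3) ^ L) := by
          gcongr
      _ = _ := by rw [pow_add, pow_mul, div_pow, inv_pow]; ring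
  have hκv : 0 < κ * ‖v‖ := by positivity
  have hle := MeasureTheory.norm_integral_le_of_norm_le
    ((integrable_abs_pow_mul_exp (m + 3 * L) (b := (κ * ‖v‖) ^ 2) (by positivity)).const_mul
      (C * (‖v‖ ^ 2)⁻¹ ^ m)) (Eventually.of_forall hbound)
  rw [MeasureTheory.integral_const_mul, integral_abs_pow_mul_exp _ hκv] at hle
  have hnv : ‖v / (√Real.pi : ℂ)‖ = ‖v‖ * (√Real.pi)⁻¹ := by
    rw [norm_div, Complex.norm_real, Real.norm_of_nonneg (Real.sqrt_nonneg _), div_eq_mul_inv]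
  rw [hnv]
  refine (mul_le_mul_of_nonneg_left hle (by positivity)).trans (le_of_eq ?_)
  change _ * (_ * (_ * G)) = _
  simp only [inv_pow]
  field_simp
  ring

/-- The Poincaré expansion of the normalized moments in powers of `v ^ (-6)`, uniformly in
sectors `κ ^ 2 * ‖v‖ ^ 2 ≤ Re (v ^ 2)`. -/
theorem exists_norm_saddleMoment_sub_sum_le (m N : ℕ) {κ : ℝ} (hκ : 0 < κ) :
    ∃ C : ℝ, 0 ≤ C ∧ ∀ v : ℂ, 0 < v.re → κ ^ 2 * ‖v‖ ^ 2 ≤ (v ^ 2).re → 1 ≤ ‖v‖ →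
      ‖saddleMoment m v - ∑ j ∈ Finset.range N, saddleCoeff m j * ((v ^ 6)⁻¹) ^ j‖ ≤
        C * ((‖v‖ ^ 6)⁻¹) ^ N := by
  have h6 : ∀ v : ℂ, (v ^ 6)⁻¹ = ((v ^ 3)⁻¹) ^ 2 := fun v => by rw [inv_pow, ← pow_mul]
  have h6' : ∀ v : ℝ, (v ^ 6)⁻¹ = ((v ^ 3)⁻¹) ^ 2 := fun v => by rw [inv_pow, ← pow_mul]
  rcases le_total m (2 * N) with h | h
  · obtain ⟨C, hC0, hC⟩ := exists_norm_saddleMoment_sub_le m (2 * N - m) hκ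
    refine ⟨C, hC0, fun v hv hv2 _ => ?_⟩
    rw [h6, h6', ← sum_range_saddleTerm, ← pow_mul]
    simpa [Nat.add_sub_cancel' h] using hC v hv hv2
  · obtain ⟨C, hC0, hC⟩ := exists_norm_saddleMoment_sub_le m 0 hκ
    refine ⟨C, hC0, fun v hv hv2 h1 => ?_⟩
    have h2 := hC v hv hv2
    rw [h6, h6', ← sum_range_saddleTerm, ← pow_mul]
    have hz : ∀ k ≤ m, ∑ i ∈ Finset.range k, saddleTerm m i * ((v ^ 3)⁻¹) ^ i = 0 := fun k hk =>
      Finset.sum_eq_zero fun i hi => by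
        rw [saddleTerm, if_pos ((Finset.mem_range.1 hi).trans_le hk), zero_mul]
    rw [add_zero, hz m le_rfl] at h2
    rw [hz _ h]
    refine h2.trans (mul_le_mul_of_nonneg_left ?_ hC0)
    exact pow_le_pow_of_le_one (by positivity) (inv_le_one_of_one_le₀ (one_le_pow₀ h1)) h

/-- The derivatives of `Ai` in terms of the normalized moments at the saddle point. -/
theorem iteratedDeriv_airyAi_eq_sum (k : ℕ) {v : ℂ} (hv : v ≠ 0) (hv2 : 0 < (v ^ 2).re) :
    iteratedDeriv k airyAi (v ^ 4) =
      (-1) ^ k * (Complex.exp (-(2 / 3 * v ^ 6)) / (2 * √Real.pi * v)) * (v ^ 2) ^ k *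
        ∑ m ∈ Finset.range (k + 1), k.choose m * saddleMoment m v := by
  have hpi : (√Real.pi : ℂ) ≠ 0 := by
    exact_mod_cast (Real.sqrt_pos.2 Real.pi_pos).ne'
  have hpi2 : (Real.pi : ℂ) = (√Real.pi : ℂ) ^ 2 := by
    exact_mod_cast (Real.sq_sqrt Real.pi_pos.le).symm
  rw [iteratedDeriv_airyAi_eq_integral k _ hv2]
  have hs : ∀ s : ℝ, airyKernel k (v ^ 4) (v ^ 2 + s * Complex.I) =
      Complex.exp (-(2 / 3 * v ^ 6)) * (v ^ 2) ^ k * ∑ m ∈ Finset.range (k + 1), k.choose m *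
      ((Complex.I * s / v ^ 2) ^ m *
    (Complex.exp (-v ^ 2 * (s : ℂ) ^ 2) * Complex.exp (-(Complex.I * (s : ℂ) ^ 3 / 3)))) := by
    intro s
    have h1 : (v ^ 2 + s * Complex.I) ^ k =
        (v ^ 2) ^ k * ∑ m ∈ Finset.range (k + 1), k.choose m * (Complex.I * s / v ^ 2) ^ m := by
      rw [show (v ^ 2 + s * Complex.I) = v ^ 2 * (Complex.I * s / v ^ 2 + 1) by field_simp; ring,
        mul_pow, add_pow]
      simp [mul_comm]
    rw [airyKernel, h1, Finset.mul_sum, Finset.mul_sum, Finset.sum_mul]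
    refine Finset.sum_congr rfl fun m _ => ?_
    rw [show (v ^ 2 + s * Complex.I) ^ 3 / 3 - v ^ 4 * (v ^ 2 + s * Complex.I) =
      -(2 / 3 * v ^ 6) + (-v ^ 2 * (s : ℂ) ^ 2 + -(Complex.I * (s : ℂ) ^ 3 / 3)) by
        linear_combination (v ^ 2 * (s : ℂ) ^ 2 + (s : ℂ) ^ 3 * Complex.I / 3) * Complex.I_sq,
      Complex.exp_add, Complex.exp_add]
    ring
  simp_rw [hs]
  rw [MeasureTheory.integral_const_mul, MeasureTheory.integral_finsetSum _ fun m _ =>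
    (integrable_saddle m hv2).const_mul _]
  simp_rw [MeasureTheory.integral_const_mul]
  simp only [Finset.mul_sum]
  refine Finset.sum_congr rfl fun m _ => ?_
  rw [saddleMoment, hpi2]
  field_simp

/-! ### Moment functionals on polynomials and Hankel determinants -/

/-- The linear functional on polynomials in several variables that treats the variables as
independent: it sends the monomial `∏ X i ^ e i` to `∏ ν i (e i)`, where `ν i k` plays the role
of the `k`-th moment of the variable `X i`. -/
def momentFunctional {ι A : Type*} [Fintype ι] [CommRing A] [Algebra ℂ A] (ν : ι → ℕ → A) :
    MvPolynomial ι ℂ →ₗ[ℂ] A :=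
  (MvPolynomial.basisMonomials ι ℂ).constr ℂ fun e => ∏ i, ν i (e i)

section MomentFunctional

variable {ι κ A : Type*} [Fintype ι] [Fintype κ] [CommRing A] [Algebra ℂ A]

theorem momentFunctional_monomial (ν : ι → ℕ → A) (e : ι →₀ ℕ) (c : ℂ) :
    momentFunctional ν (MvPolynomial.monomial e c) = c • ∏ i, ν i (e i) := by
  have h : MvPolynomial.monomial e c = c • MvPolynomial.basisMonomials ι ℂ e := by
    simp [MvPolynomial.smul_monomial]
  rw [h, map_smul, momentFunctional, Module.Basis.constr_basis]

theorem momentFunctional_apply (ν : ι → ℕ → A) (p : MvPolynomial ι ℂ) :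
    momentFunctional ν p = ∑ e ∈ p.support, p.coeff e • ∏ i, ν i (e i) := by
  conv_lhs => rw [p.as_sum, map_sum]
  exact Finset.sum_congr rfl fun e _ => momentFunctional_monomial ν e _

theorem momentFunctional_prod_pow (ν : ι → ℕ → A) (e : ι → ℕ) :
    momentFunctional ν (∏ i, (MvPolynomial.X i : MvPolynomial ι ℂ) ^ e i) = ∏ i, ν i (e i) := by
  have h : (∏ i, (MvPolynomial.X i : MvPolynomial ι ℂ) ^ e i) =
      MvPolynomial.monomial (Finsupp.equivFunOnFinite.symm e) 1 := by
    rw [MvPolynomial.monomial_eq, Finsupp.prod_fintype _ _ (fun i => pow_zero _)]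
    simp
  rw [h, momentFunctional_monomial]
  simp

theorem momentFunctional_prod_sum (ν : ι → ℕ → A) (t : ι → Finset ℕ) (c : ι → ℕ → ℂ) :
    momentFunctional ν (∏ i, ∑ k ∈ t i, c i k • MvPolynomial.X i ^ k) =
      ∏ i, ∑ k ∈ t i, c i k • ν i k := by
  classical
  rw [Finset.prod_univ_sum, Finset.prod_univ_sum, map_sum]
  refine Finset.sum_congr rfl fun e _ => ?_
  simp_rw [Finset.prod_smul, map_smul, momentFunctional_prod_pow]

theorem momentFunctional_rename (σ : ι ≃ κ) (ν : κ → ℕ → A) (p : MvPolynomial ι ℂ) :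
    momentFunctional ν (MvPolynomial.rename σ p) = momentFunctional (fun i => ν (σ i)) p := by
  induction p using MvPolynomial.induction_on' with
  | monomial e c =>
    rw [MvPolynomial.rename_monomial, momentFunctional_monomial, momentFunctional_monomial,
      ← Equiv.prod_comp σ]
    congr 1
    refine Finset.prod_congr rfl fun i _ => ?_
    rw [Finsupp.mapDomain_apply σ.injective]
  | add p q hp hq => rw [map_add, map_add, map_add, hp, hq]

/-- The moments of affine images of the variables. -/
theorem momentFunctional_eq_aeval {ν μ : ι → ℕ → ℂ} {P ρ : ι → ℂ}
    (h : ∀ i k, μ i k = P i * ρ i ^ k * ∑ m ∈ Finset.range (k + 1), k.choose m * ν i m)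
    (p : MvPolynomial ι ℂ) :
    momentFunctional μ p = (∏ i, P i) * momentFunctional ν
      (MvPolynomial.aeval (fun i => MvPolynomial.C (ρ i) * (1 + MvPolynomial.X i)) p) := by
  induction p using MvPolynomial.induction_on' with
  | monomial e c =>
    rw [momentFunctional_monomial, MvPolynomial.aeval_monomial,
      Finsupp.prod_fintype _ _ (fun i => pow_zero _)]
    have h1 : ∀ i, (MvPolynomial.C (ρ i) * (1 + MvPolynomial.X i) : MvPolynomial ι ℂ) ^ e i =
        ∑ k ∈ Finset.range (e i + 1),
          (ρ i ^ e i * (e i).choose k) • MvPolynomial.X i ^ k := fun i => by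
      rw [mul_pow, add_comm, add_pow, Finset.mul_sum]
      refine Finset.sum_congr rfl fun k _ => ?_
      rw [MvPolynomial.smul_eq_C_mul]
      simp
      ring
    simp_rw [h1]
    rw [MvPolynomial.algebraMap_eq, ← MvPolynomial.smul_eq_C_mul, map_smul,
      momentFunctional_prod_sum, smul_eq_mul, smul_eq_mul, mul_left_comm, ← Finset.prod_mul_distrib]
    congr 1
    refine Finset.prod_congr rfl fun i _ => ?_
    rw [h, mul_assoc, Finset.mul_sum]
    simp [mul_assoc]
  | add p q hp hq => rw [map_add, map_add, map_add, hp, hq, mul_add]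

theorem momentFunctional_add {μ₁ μ₂ : ℕ → A} (c₁ c₂ : A) [DecidableEq ι] (p : MvPolynomial ι ℂ) :
    momentFunctional (fun (_ : ι) k => c₁ * μ₁ k + c₂ * μ₂ k) p =
      ∑ s ∈ (Finset.univ : Finset ι).powerset, c₁ ^ s.card * c₂ ^ (Fintype.card ι - s.card) *
        momentFunctional (fun i => if i ∈ s then μ₁ else μ₂) p := by
  induction p using MvPolynomial.induction_on' with
  | monomial e c =>
    simp_rw [momentFunctional_monomial, mul_smul_comm]
    rw [Finset.prod_add, Finset.smul_sum]
    refine Finset.sum_congr rfl fun s _ => ?_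
    rw [Finset.prod_mul_distrib, Finset.prod_mul_distrib, Finset.prod_const, Finset.prod_const,
      Finset.card_sdiff_of_subset (Finset.subset_univ s), Finset.card_univ,
      ← Finset.prod_sdiff (Finset.subset_univ s)]
    have h1 : ∏ i ∈ s, (if i ∈ s then μ₁ else μ₂) (e i) = ∏ i ∈ s, μ₁ (e i) :=
      Finset.prod_congr rfl fun i hi => by rw [if_pos hi]
    have h2 : ∏ i ∈ Finset.univ \ s, (if i ∈ s then μ₁ else μ₂) (e i) =
        ∏ i ∈ Finset.univ \ s, μ₂ (e i) :=
      Finset.prod_congr rfl fun i hi => by rw [if_neg (Finset.mem_sdiff.1 hi).2]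
    rw [h1, h2]
    congr 1
    ring
  | add p q hp hq => simp_rw [map_add, mul_add, Finset.sum_add_distrib, hp, hq]

theorem momentFunctional_addCases {r m : ℕ} (ν₁ : Fin r → ℕ → A) (ν₂ : Fin m → ℕ → A)
    (p : MvPolynomial (Fin r) ℂ) (q : MvPolynomial (Fin m) ℂ) :
    momentFunctional (Fin.addCases ν₁ ν₂ : Fin (r + m) → ℕ → A)
      (MvPolynomial.rename (Fin.castAdd m) p * MvPolynomial.rename (Fin.natAdd r) q) =
      momentFunctional ν₁ p * momentFunctional ν₂ q := by
  induction p using MvPolynomial.induction_on' with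
  | add p p' hp hp' => rw [map_add, map_add, add_mul, map_add, hp, hp', add_mul]
  | monomial e c =>
    induction q using MvPolynomial.induction_on' with
    | add q q' hq hq' => rw [map_add, map_add, mul_add, map_add, hq, hq', mul_add]
    | monomial e' c' =>
      rw [MvPolynomial.rename_monomial, MvPolynomial.rename_monomial, MvPolynomial.monomial_mul,
        momentFunctional_monomial, momentFunctional_monomial, momentFunctional_monomial,
        Fin.prod_univ_add, smul_mul_smul_comm]
      congr 2
      · refine Finset.prod_congr rfl fun i _ => ?_
        have : Finsupp.mapDomain (Fin.natAdd r) e' (Fin.castAdd m i) = 0 :=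
          Finsupp.mapDomain_of_notMem_range _ _ (by
            rintro ⟨j, hj⟩
            have := congrArg Fin.val hj
            simp at this; omega)
        rw [Fin.addCases_left, Finsupp.add_apply, this,
          Finsupp.mapDomain_apply (Fin.castAdd_injective r m), add_zero]
      · refine Finset.prod_congr rfl fun i _ => ?_
        have : Finsupp.mapDomain (Fin.castAdd m) e (Fin.natAdd r i) = 0 :=
          Finsupp.mapDomain_of_notMem_range _ _ (by
            rintro ⟨j, hj⟩
            have := congrArg Fin.val hj
            simp at this; omega)
        rw [Fin.addCases_right, Finsupp.add_apply, this,
          Finsupp.mapDomain_apply (Fin.natAdd_injective m r), zero_add]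

end MomentFunctional

/-- The Vandermonde polynomial `∏_{i < j} (X j - X i)` in `n` variables. -/
def vandermondePoly (n : ℕ) : MvPolynomial (Fin n) ℂ :=
  (Matrix.vandermonde MvPolynomial.X).det

theorem rename_vandermondePoly {n : ℕ} (σ : Equiv.Perm (Fin n)) :
    MvPolynomial.rename σ (vandermondePoly n) = (σ.sign : ℤ) * vandermondePoly n := by
  rw [vandermondePoly, AlgHom.map_det, ← Matrix.det_permute]
  congr 1
  ext i j
  simp [Matrix.vandermonde_apply]

theorem rename_vandermondePoly_sq {n : ℕ} (σ : Equiv.Perm (Fin n)) :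
    MvPolynomial.rename σ (vandermondePoly n ^ 2) = vandermondePoly n ^ 2 := by
  rw [map_pow, rename_vandermondePoly, mul_pow, ← Int.cast_pow, ← Units.val_pow_eq_pow_val,
    Int.units_sq]
  simp

theorem aeval_vandermondePoly {S : Type*} [CommRing S] [Algebra ℂ S] {n : ℕ} (g : Fin n → S) :
    MvPolynomial.aeval g (vandermondePoly n) = (Matrix.vandermonde g).det := by
  rw [vandermondePoly, AlgHom.map_det]
  congr 1
  ext i j
  simp [Matrix.vandermonde_apply]

theorem det_vandermonde_mul {S : Type*} [CommRing S] {n : ℕ} (c : S) (g : Fin n → S) :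
    (Matrix.vandermonde fun i => c * g i).det =
      c ^ (n.choose 2) * (Matrix.vandermonde g).det := by
  have h : (Matrix.vandermonde fun i => c * g i) =
      Matrix.of fun i j : Fin n => c ^ (j : ℕ) * Matrix.vandermonde g i j := by
    ext i j
    simp [Matrix.vandermonde_apply, mul_pow]
  rw [h, Matrix.det_mul_row, Finset.prod_pow_eq_pow_sum, Fin.sum_univ_eq_sum_range (fun i => i),
    Finset.sum_range_id, Nat.choose_two_right]

theorem det_vandermonde_add {S : Type*} [CommRing S] {r m : ℕ} (g : Fin (r + m) → S) :
    (Matrix.vandermonde g).det =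
      (Matrix.vandermonde fun i => g (Fin.castAdd m i)).det *
      (Matrix.vandermonde fun i => g (Fin.natAdd r i)).det *
      ∏ i : Fin r, ∏ j : Fin m, (g (Fin.natAdd r j) - g (Fin.castAdd m i)) := by
  have h : ∀ (k : ℕ) (i : Fin k) (f : Fin k → S),
      ∏ j ∈ Finset.Ioi i, f j = ∏ j, if i < j then f j else 1 := fun k i f => by
    rw [← Finset.prod_filter]
    congr 1
    ext j
    simp
  simp_rw [Matrix.det_vandermonde, h]
  rw [Fin.prod_univ_add]
  simp_rw [Fin.prod_univ_add]
  have h1 : ∀ (i : Fin r) (j : Fin m), Fin.castAdd m i < Fin.natAdd r j := fun i j => by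
    rw [Fin.lt_def]; simp; omega
  have h2 : ∀ (i : Fin m) (j : Fin r), ¬ Fin.natAdd r i < Fin.castAdd m j := fun i j => by
    rw [Fin.lt_def]; simp; omega
  have h3 : ∀ (i j : Fin r), Fin.castAdd m i < Fin.castAdd m j ↔ i < j := fun i j => by
    rw [Fin.lt_def, Fin.lt_def]; simp
  have h4 : ∀ (i j : Fin m), Fin.natAdd r i < Fin.natAdd r j ↔ i < j := fun i j => by
    rw [Fin.lt_def, Fin.lt_def]; simp
  simp only [h1, h2, h3, h4, if_true, if_false, Finset.prod_const_one, one_mul,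
    Finset.prod_mul_distrib]
  ring

/-- A discrete form of the Andréief identity. -/
theorem momentFunctional_vandermondePoly_sq {A : Type*} [CommRing A] [Algebra ℂ A] {n : ℕ}
    (ν : Fin n → ℕ → A) :
    momentFunctional ν (vandermondePoly n ^ 2) =
      ∑ σ : Equiv.Perm (Fin n), (Matrix.of fun j k : Fin n => ν (σ j) (j + k)).det := by
  have key : ∀ ν : Fin n → ℕ → A, momentFunctional ν
      ((∏ i : Fin n, MvPolynomial.X i ^ (i : ℕ)) * vandermondePoly n) =
      (Matrix.of fun j k : Fin n => ν j (j + k)).det := fun ν => by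
    rw [vandermondePoly, Matrix.det_apply', Matrix.det_apply', Finset.mul_sum, map_sum]
    refine Finset.sum_congr rfl fun τ _ => ?_
    have h1 : (∏ i : Fin n, MvPolynomial.X i ^ (i : ℕ)) * (((τ.sign : ℤ) : MvPolynomial (Fin n) ℂ) *
        ∏ i, Matrix.vandermonde MvPolynomial.X (τ i) i) =
        ((τ.sign : ℤ) : ℂ) • ∏ i : Fin n, MvPolynomial.X i ^ ((i : ℕ) + (τ.symm i : ℕ)) := by
      rw [MvPolynomial.smul_eq_C_mul, mul_left_comm]
      have h3 : ∏ i : Fin n, (MvPolynomial.X i : MvPolynomial (Fin n) ℂ) ^ (τ.symm i : ℕ) =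
          ∏ i, Matrix.vandermonde MvPolynomial.X (τ i) i := by
        rw [← Equiv.prod_comp τ]
        simp [Matrix.vandermonde_apply]
      simp_rw [pow_add]
      rw [Finset.prod_mul_distrib, h3]
      simp
    rw [h1, map_smul, momentFunctional_prod_pow, ← Equiv.prod_comp τ, Algebra.smul_def]
    simp
  -- Expand one of the two factors over permutations; relabelling the variables turns every term
  -- into the same one, because the antisymmetry of the other factor absorbs the sign.
  have h2 : vandermondePoly n ^ 2 = ∑ σ : Equiv.Perm (Fin n),
      MvPolynomial.rename σ ((∏ i : Fin n, MvPolynomial.X i ^ (i : ℕ)) * vandermondePoly n) := by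
    simp_rw [map_mul, rename_vandermondePoly, sq]
    conv_lhs => enter [1]; rw [vandermondePoly, Matrix.det_apply']
    rw [Finset.sum_mul]
    refine Finset.sum_congr rfl fun σ _ => ?_
    simp only [Matrix.vandermonde_apply, map_prod, map_pow, MvPolynomial.rename_X]
    ring
  rw [h2, map_sum]
  refine Finset.sum_congr rfl fun σ _ => ?_
  rw [momentFunctional_rename, key]

theorem momentFunctional_vandermondePoly_sq_const {A : Type*} [CommRing A] [Algebra ℂ A] (n : ℕ)
    (μ : ℕ → A) :
    momentFunctional (fun _ : Fin n => μ) (vandermondePoly n ^ 2) =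
      n.factorial * (Matrix.of fun j k : Fin n => μ (j + k)).det := by
  rw [momentFunctional_vandermondePoly_sq]
  simp [Fintype.card_perm]

/-- If the index set is relabelled, only the number of variables of each kind matters. -/
theorem momentFunctional_ite_vandermondePoly_sq {A : Type*} [CommRing A] [Algebra ℂ A] {r m : ℕ}
    (μ₁ μ₂ : ℕ → A) {s : Finset (Fin (r + m))} (hs : s.card = r) :
    momentFunctional (fun i => if i ∈ s then μ₁ else μ₂) (vandermondePoly (r + m) ^ 2) =
      momentFunctional (Fin.addCases (fun _ => μ₁) (fun _ => μ₂) : Fin (r + m) → ℕ → A)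
        (vandermondePoly (r + m) ^ 2) := by
  have hc : sᶜ.card = m := by rw [Finset.card_compl, hs, Fintype.card_fin]; omega
  set σ : Equiv.Perm (Fin (r + m)) := finSumFinEquiv.symm.trans (finSumEquivOfFinset hs hc)
  rw [← rename_vandermondePoly_sq σ, momentFunctional_rename, rename_vandermondePoly_sq]
  congr 1
  congr 1
  funext i
  induction i using Fin.addCases with
  | left i =>
    have : σ (Fin.castAdd m i) ∈ s := by simp [σ]
    rw [if_pos this, Fin.addCases_left]
  | right i =>
    have : σ (Fin.natAdd r i) ∉ s := by
      have h : σ (Fin.natAdd r i) = sᶜ.orderEmbOfFin hc i := by simp [σ]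
      rw [h]
      exact Finset.mem_compl.1 (Finset.orderEmbOfFin_mem sᶜ hc i)
    rw [if_neg this, Fin.addCases_right]

/-- The part of a two-component Hankel determinant in which `r` of the variables carry the
moments `μ₁` and `m` carry the moments `μ₂`. -/
def mixedHankel (r m : ℕ) (μ₁ μ₂ : ℕ → ℂ) : ℂ :=
  momentFunctional (Fin.addCases (fun _ => μ₁) (fun _ => μ₂) : Fin (r + m) → ℕ → ℂ)
    (vandermondePoly (r + m) ^ 2) / (r.factorial * m.factorial)

theorem det_hankel_add (n : ℕ) (μ₁ μ₂ : ℕ → ℂ) (c₁ c₂ : ℂ) :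
    (Matrix.of fun j k : Fin n => c₁ * μ₁ (j + k) + c₂ * μ₂ (j + k)).det =
      ∑ r ∈ Finset.range (n + 1), c₁ ^ r * c₂ ^ (n - r) * mixedHankel r (n - r) μ₁ μ₂ := by
  have hn : (n.factorial : ℂ) ≠ 0 := by exact_mod_cast n.factorial_ne_zero
  refine mul_left_cancel₀ hn ?_
  rw [← momentFunctional_vandermondePoly_sq_const n fun k => c₁ * μ₁ k + c₂ * μ₂ k,
    momentFunctional_add, Finset.sum_powerset, Finset.mul_sum, Finset.card_univ, Fintype.card_fin]
  refine Finset.sum_congr rfl fun r hr => ?_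
  have hrn : r ≤ n := Nat.lt_succ_iff.1 (Finset.mem_range.1 hr)
  obtain ⟨m, rfl⟩ := Nat.exists_eq_add_of_le hrn
  rw [Nat.add_sub_cancel_left]
  have h : ∀ s ∈ Finset.powersetCard r (Finset.univ : Finset (Fin (r + m))),
      c₁ ^ s.card * c₂ ^ (r + m - s.card) * momentFunctional (fun i => if i ∈ s then μ₁ else μ₂)
        (vandermondePoly (r + m) ^ 2) = c₁ ^ r * c₂ ^ m *
      momentFunctional (Fin.addCases (fun _ => μ₁) (fun _ => μ₂) : Fin (r + m) → ℕ → ℂ)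
        (vandermondePoly (r + m) ^ 2) := fun s hs => by
    have hs' := (Finset.mem_powersetCard.1 hs).2
    rw [momentFunctional_ite_vandermondePoly_sq μ₁ μ₂ hs', hs', Nat.add_sub_cancel_left]
  rw [Finset.sum_congr rfl h, Finset.sum_const, Finset.card_powersetCard, Finset.card_univ,
    Fintype.card_fin, mixedHankel, ← Nat.add_choose_mul_factorial_mul_factorial, nsmul_eq_mul]
  have h1 : (r.factorial : ℂ) ≠ 0 := by exact_mod_cast r.factorial_ne_zero
  have h2 : (m.factorial : ℂ) ≠ 0 := by exact_mod_cast m.factorial_ne_zero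
  push_cast
  rw [show (r + m).choose m = (r + m).choose r by rw [← Nat.choose_symm_add]]
  field_simp

/-! ### The Hankel determinant of the Gaussian moments -/

theorem choose_mul_gaussMoment (j i : ℕ) :
    (j.choose i : ℂ) * gaussMoment (j + 1 - i) =
      (i + 1) * (j.choose (i + 1) * gaussMoment (j + 1 - (i + 2))) := by
  rcases lt_trichotomy j i with h | rfl | h
  · rw [Nat.choose_eq_zero_of_lt h, Nat.choose_eq_zero_of_lt (by omega)]; simp
  · rw [Nat.choose_succ_self, show j + 1 - j = 1 by omega]; simp [gaussMoment]
  · obtain ⟨d, rfl⟩ := Nat.exists_eq_add_of_lt h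
    rw [show i + d + 1 + 1 - i = d + 2 by omega, show i + d + 1 + 1 - (i + 2) = d by omega,
      gaussMoment]
    have := Nat.choose_succ_right_eq (i + d + 1) i
    rw [show i + d + 1 - i = d + 1 by omega] at this
    have : ((i + d + 1).choose (i + 1) : ℂ) * (i + 1) = (i + d + 1).choose i * (d + 1) := by
      exact_mod_cast this
    push_cast
    linear_combination (-(gaussMoment d : ℂ)) * this

/-- The coefficient of the `i`-th Hermite polynomial in the expansion of `x ^ j`. -/
def hermiteCoeff (j i : ℕ) : ℂ := j.choose i * gaussMoment (j - i)

theorem hermiteCoeff_of_lt {j i : ℕ} (h : j < i) : hermiteCoeff j i = 0 := by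
  simp [hermiteCoeff, Nat.choose_eq_zero_of_lt h]

theorem hermiteCoeff_self (j : ℕ) : hermiteCoeff j j = 1 := by
  simp [hermiteCoeff, gaussMoment]

theorem hermiteCoeff_zero (j : ℕ) : hermiteCoeff j 0 = gaussMoment j := by
  simp [hermiteCoeff]

theorem hermiteCoeff_succ_zero (j : ℕ) : hermiteCoeff (j + 1) 0 = hermiteCoeff j 1 := by
  have := choose_mul_gaussMoment j 0
  simpa [hermiteCoeff] using this

/-- The three-term recurrence of the Hermite polynomials. -/
theorem hermiteCoeff_succ_succ (j i : ℕ) :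
    hermiteCoeff (j + 1) (i + 1) = hermiteCoeff j i + (i + 2) * hermiteCoeff j (i + 2) := by
  have := choose_mul_gaussMoment j (i + 1)
  rw [show j + 1 - (i + 1) = j - i by omega, show j + 1 - (i + 1 + 2) = j - (i + 2) by omega] at this
  rw [hermiteCoeff, hermiteCoeff, hermiteCoeff, Nat.choose_succ_succ,
    show j + 1 - (i + 1) = j - i by omega]
  push_cast at this ⊢
  linear_combination this

/-- Orthogonality of the Hermite polynomials, as a factorization of the Gaussian moments. -/
theorem sum_hermiteCoeff (N j k : ℕ) (h : j < N) :
    ∑ i ∈ Finset.range N, hermiteCoeff j i * i.factorial * hermiteCoeff k i =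
      gaussMoment (j + k) := by
  induction j generalizing k with
  | zero =>
    rw [Finset.sum_eq_single_of_mem 0 (Finset.mem_range.2 h)]
    · rw [hermiteCoeff_self, hermiteCoeff_zero]; simp
    · intro i _ hi
      rw [hermiteCoeff_of_lt (Nat.pos_of_ne_zero hi)]; simp
  | succ j ih =>
    -- Multiplication by `x` is symmetric for the pairing with weights `i!`, so that a factor `x`
    -- can be moved from `x ^ (j + 1)` to `x ^ k`.
    rw [show j + 1 + k = j + (k + 1) by ring, ← ih (k + 1) (by omega)]
    obtain ⟨M, rfl⟩ : ∃ M, N = M + 1 := ⟨N - 1, by omega⟩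
    have hL : ∀ j k : ℕ, j < M → ∑ i ∈ Finset.range (M + 1),
        hermiteCoeff (j + 1) i * i.factorial * hermiteCoeff k i =
        ∑ i ∈ Finset.range M, hermiteCoeff j i * (i + 1).factorial * hermiteCoeff k (i + 1) +
        ∑ i ∈ Finset.range M, hermiteCoeff j (i + 1) * (i + 1).factorial * hermiteCoeff k i := by
      intro j k hj
      have h1 : ∑ i ∈ Finset.range M, hermiteCoeff j (i + 1) * (i + 1).factorial * hermiteCoeff k i =
          ∑ i ∈ Finset.range (M + 1),
            hermiteCoeff j (i + 1) * (i + 1).factorial * hermiteCoeff k i := by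
        rw [Finset.sum_range_succ, hermiteCoeff_of_lt (by omega : j < M + 1)]; simp
      rw [h1, Finset.sum_range_succ', Finset.sum_range_succ' _ M, ← add_assoc,
        ← Finset.sum_add_distrib, hermiteCoeff_succ_zero]
      congr 1
      · refine Finset.sum_congr rfl fun i _ => ?_
        rw [hermiteCoeff_succ_succ, Nat.factorial_succ (i + 1)]
        push_cast
        ring
    have hR : ∑ i ∈ Finset.range (M + 1),
        hermiteCoeff j i * i.factorial * hermiteCoeff (k + 1) i =
        ∑ i ∈ Finset.range M, hermiteCoeff j i * (i + 1).factorial * hermiteCoeff k (i + 1) +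
        ∑ i ∈ Finset.range M, hermiteCoeff j (i + 1) * (i + 1).factorial * hermiteCoeff k i := by
      have h1 : ∑ i ∈ Finset.range M, hermiteCoeff j i * (i + 1).factorial * hermiteCoeff k (i + 1) =
          ∑ i ∈ Finset.range (M + 1),
            hermiteCoeff j i * (i + 1).factorial * hermiteCoeff k (i + 1) := by
        rw [Finset.sum_range_succ, hermiteCoeff_of_lt (by omega : j < M)]; simp
      rw [h1, Finset.sum_range_succ', Finset.sum_range_succ' _ M, add_right_comm,
        ← Finset.sum_add_distrib, hermiteCoeff_succ_zero]
      congr 1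
      · refine Finset.sum_congr rfl fun i _ => ?_
        rw [hermiteCoeff_succ_succ, Nat.factorial_succ (i + 1)]
        push_cast
        ring
    rw [hL j k (by omega), hR]

theorem det_gaussMoment (n : ℕ) :
    (Matrix.of fun j k : Fin n => (gaussMoment (j + k) : ℂ)).det =
      ∏ k ∈ Finset.range n, (k.factorial : ℂ) := by
  set T : Matrix (Fin n) (Fin n) ℂ := Matrix.of fun j i => hermiteCoeff j i
  have hT : T.det = 1 := by
    rw [Matrix.det_of_isLowerTriangular]
    · simp [T, hermiteCoeff_self]
    · intro i j hij
      exact hermiteCoeff_of_lt (by simpa using hij)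
  have h : (Matrix.of fun j k : Fin n => (gaussMoment (j + k) : ℂ)) =
      T * Matrix.diagonal (fun i : Fin n => ((i : ℕ).factorial : ℂ)) * T.transpose := by
    ext j k
    rw [Matrix.mul_apply]
    simp only [Matrix.mul_diagonal, Matrix.of_apply, Matrix.transpose_apply, T]
    rw [Fin.sum_univ_eq_sum_range
      (fun i => hermiteCoeff j i * (i.factorial : ℂ) * hermiteCoeff k i) n,
      sum_hermiteCoeff n j k j.2]
  rw [h, Matrix.det_mul, Matrix.det_mul, Matrix.det_transpose, hT, Matrix.det_diagonal, one_mul,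
    mul_one, Fin.prod_univ_eq_prod_range (fun i => (i.factorial : ℂ))]

/-- The moments of a centred Gaussian variable of (complex) variance `V`. -/
def complexGaussMoment (V : ℂ) (m : ℕ) : ℂ := V ^ (m / 2) * gaussMoment m

/-- Mehta's integral, in algebraic form: the mean of the squared Vandermonde determinant of
independent Gaussian variables. -/
theorem momentFunctional_complexGaussMoment (n : ℕ) (V : ℂ) :
    momentFunctional (fun _ : Fin n => complexGaussMoment V) (vandermondePoly n ^ 2) =
      n.factorial * V ^ (n.choose 2) * barnesG (n + 1) := by
  obtain ⟨b, rfl⟩ : ∃ b : ℂ, b ^ 2 = V := ⟨V ^ (2⁻¹ : ℂ), by simp [← Complex.cpow_nat_mul]⟩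
  have hb : ∀ m, complexGaussMoment (b ^ 2) m = b ^ m * gaussMoment m := fun m => by
    rcases Nat.even_or_odd' m with ⟨q, rfl | rfl⟩
    · rw [complexGaussMoment, ← pow_mul, Nat.mul_div_cancel_left _ two_pos]
    · rw [complexGaussMoment, gaussMoment_odd]; simp
  have h : (Matrix.of fun j k : Fin n => complexGaussMoment (b ^ 2) (j + k)) =
      Matrix.of fun j k : Fin n => b ^ (j : ℕ) *
        (Matrix.of fun j k : Fin n => b ^ (k : ℕ) *
          (Matrix.of fun j k : Fin n => (gaussMoment (j + k) : ℂ)) j k) j k := by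
    ext j k
    simp only [Matrix.of_apply]
    rw [hb, pow_add, mul_assoc]
  rw [momentFunctional_vandermondePoly_sq_const, h, Matrix.det_mul_column, Matrix.det_mul_row,
    det_gaussMoment, Finset.prod_pow_eq_pow_sum, Fin.sum_univ_eq_sum_range (fun i => i),
    Finset.sum_range_id, Nat.choose_two_right, barnesG]
  push_cast
  ring

/-! ### Poincaré expansions and formal power series -/

/-- The function `f` has along `l` the asymptotic expansion `∑ S_j ε ^ j` in the (bounded)
gauge `ε`, where `S` collects the coefficients. -/
def HasGaugeExpansion (l : Filter ℂ) (ε f : ℂ → ℂ) (S : PowerSeries ℂ) : Prop :=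
  ∀ N : ℕ, (fun z => f z - (S.trunc N).eval (ε z)) =O[l] fun z => ε z ^ N

section GaugeExpansion

variable {l : Filter ℂ} {ε : ℂ → ℂ}

theorem isBigO_one_eval (hε : ε =O[l] fun _ => (1 : ℂ)) (p : Polynomial ℂ) :
    (fun z => p.eval (ε z)) =O[l] fun _ => (1 : ℂ) := by
  simp_rw [Polynomial.eval_eq_sum_range]
  refine IsBigO.fun_sum fun i _ => ?_
  simpa using (hε.pow i).const_mul_left (p.coeff i)

theorem HasGaugeExpansion.isBigO_one {f : ℂ → ℂ} {S : PowerSeries ℂ}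
    (h : HasGaugeExpansion l ε f S) : f =O[l] fun _ => (1 : ℂ) := by
  simpa using h 0

theorem hasGaugeExpansion_zero : HasGaugeExpansion l ε (fun _ => 0) 0 := fun N => by
  simpa using isBigO_zero _ l

theorem hasGaugeExpansion_one : HasGaugeExpansion l ε (fun _ => 1) 1 := fun N => by
  cases N with
  | zero => simpa using isBigO_refl (fun _ => (1 : ℂ)) l
  | succ N => simpa using isBigO_zero _ l

theorem HasGaugeExpansion.add {f g : ℂ → ℂ} {S T : PowerSeries ℂ}
    (hf : HasGaugeExpansion l ε f S) (hg : HasGaugeExpansion l ε g T) :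
    HasGaugeExpansion l ε (fun z => f z + g z) (S + T) := fun N => by
  refine ((hf N).add (hg N)).congr_left fun z => ?_
  rw [map_add, Polynomial.eval_add]; ring

theorem HasGaugeExpansion.const_smul {f : ℂ → ℂ} {S : PowerSeries ℂ}
    (hf : HasGaugeExpansion l ε f S) (c : ℂ) :
    HasGaugeExpansion l ε (fun z => c • f z) (c • S) := fun N => by
  refine ((hf N).const_mul_left c).congr_left fun z => ?_
  have : (c • S).trunc N = c • S.trunc N := by
    ext j
    simp [PowerSeries.coeff_trunc]
  rw [this, Polynomial.eval_smul]; simp only [smul_eq_mul]; ring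

theorem HasGaugeExpansion.mul (hε : ε =O[l] fun _ => (1 : ℂ)) {f g : ℂ → ℂ}
    {S T : PowerSeries ℂ} (hf : HasGaugeExpansion l ε f S) (hg : HasGaugeExpansion l ε g T) :
    HasGaugeExpansion l ε (fun z => f z * g z) (S * T) := fun N => by
  obtain ⟨Q, hQ⟩ : (Polynomial.X ^ N : Polynomial ℂ) ∣
      S.trunc N * T.trunc N - (S * T).trunc N := by
    rw [Polynomial.X_pow_dvd_iff]
    intro d hd
    rw [Polynomial.coeff_sub, PowerSeries.coeff_trunc, if_pos hd,
      PowerSeries.coeff_mul_eq_coeff_trunc_mul_trunc S T hd, sub_eq_zero]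
    rw [← Polynomial.coe_mul, Polynomial.coeff_coe]
  have h1 : (fun z => (f z - (S.trunc N).eval (ε z)) * g z) =O[l] fun z => ε z ^ N := by
    simpa using (hf N).mul hg.isBigO_one
  have h2 : (fun z => (S.trunc N).eval (ε z) * (g z - (T.trunc N).eval (ε z))) =O[l]
      fun z => ε z ^ N := by
    simpa using (isBigO_one_eval hε _).mul (hg N)
  have h3 : (fun z => ε z ^ N * Q.eval (ε z)) =O[l] fun z => ε z ^ N := by
    simpa using (isBigO_refl (fun z => ε z ^ N) l).mul (isBigO_one_eval hε Q)
  refine ((h1.add h2).add h3).congr_left fun z => ?_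
  have := congrArg (Polynomial.eval (ε z)) hQ
  simp only [Polynomial.eval_sub, Polynomial.eval_mul, Polynomial.eval_pow,
    Polynomial.eval_X] at this
  linear_combination -this

theorem HasGaugeExpansion.congr' {f g : ℂ → ℂ} {S : PowerSeries ℂ}
    (hf : HasGaugeExpansion l ε f S) (h : f =ᶠ[l] g) : HasGaugeExpansion l ε g S := fun N =>
  (hf N).congr' (h.mono fun z hz => by simp only [hz]) EventuallyEq.rfl

theorem HasGaugeExpansion.sum {ι : Type*} (s : Finset ι) {f : ι → ℂ → ℂ} {S : ι → PowerSeries ℂ}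
    (h : ∀ i ∈ s, HasGaugeExpansion l ε (f i) (S i)) :
    HasGaugeExpansion l ε (fun z => ∑ i ∈ s, f i z) (∑ i ∈ s, S i) := by
  classical
  induction s using Finset.induction_on with
  | empty => simpa using hasGaugeExpansion_zero
  | insert i s hi ih =>
    simp_rw [Finset.sum_insert hi]
    exact (h i (Finset.mem_insert_self i s)).add
      (ih fun j hj => h j (Finset.mem_insert_of_mem hj))

theorem HasGaugeExpansion.prod (hε : ε =O[l] fun _ => (1 : ℂ)) {ι : Type*} (s : Finset ι)
    {f : ι → ℂ → ℂ} {S : ι → PowerSeries ℂ}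
    (h : ∀ i ∈ s, HasGaugeExpansion l ε (f i) (S i)) :
    HasGaugeExpansion l ε (fun z => ∏ i ∈ s, f i z) (∏ i ∈ s, S i) := by
  classical
  induction s using Finset.induction_on with
  | empty => simpa using hasGaugeExpansion_one
  | insert i s hi ih =>
    simp_rw [Finset.prod_insert hi]
    exact (h i (Finset.mem_insert_self i s)).mul hε
      (ih fun j hj => h j (Finset.mem_insert_of_mem hj))

/-- Moment functionals of expandable moments are expanded by the moment functional of the
formal series. -/
theorem HasGaugeExpansion.momentFunctional (hε : ε =O[l] fun _ => (1 : ℂ)) {ι : Type*} [Fintype ι]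
    {H : ι → ℕ → ℂ → ℂ} {S : ι → ℕ → PowerSeries ℂ}
    (h : ∀ i k, HasGaugeExpansion l ε (H i k) (S i k)) (p : MvPolynomial ι ℂ) :
    HasGaugeExpansion l ε (fun z => momentFunctional (fun i k => H i k z) p)
      (momentFunctional S p) := by
  simp_rw [momentFunctional_apply]
  exact HasGaugeExpansion.sum _ fun e _ =>
    (HasGaugeExpansion.prod hε _ fun i _ => h i (e i)).const_smul _

/-- Dividing out the leading power of the gauge. -/
theorem HasGaugeExpansion.div_pow {f : ℂ → ℂ} {S : PowerSeries ℂ}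
    (hf : HasGaugeExpansion l ε f S) (hne : ∀ᶠ z in l, ε z ≠ 0) {d : ℕ}
    (hS : ∀ j < d, PowerSeries.coeff j S = 0) :
    HasGaugeExpansion l ε (fun z => f z / ε z ^ d)
      (PowerSeries.mk fun j => PowerSeries.coeff (d + j) S) := fun N => by
  have htr : S.trunc (d + N) =
      Polynomial.X ^ d * (PowerSeries.mk fun j => PowerSeries.coeff (d + j) S).trunc N := by
    ext j
    rw [PowerSeries.coeff_trunc, Polynomial.coeff_X_pow_mul', PowerSeries.coeff_trunc]
    by_cases hj : d ≤ j
    · rw [if_pos hj, PowerSeries.coeff_mk, Nat.add_sub_cancel' hj]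
      by_cases hN : j < d + N
      · rw [if_pos hN, if_pos (by omega)]
      · rw [if_neg hN, if_neg (by omega)]
    · rw [if_neg hj, hS j (by omega), ite_self]
  have h1 := (hf (d + N)).mul (isBigO_refl (fun z => (ε z ^ d)⁻¹) l)
  refine h1.congr' ?_ ?_
  · filter_upwards [hne] with z hz
    rw [htr, Polynomial.eval_mul, Polynomial.eval_pow, Polynomial.eval_X]
    field_simp
  · filter_upwards [hne] with z hz
    rw [pow_add]
    field_simp

end GaugeExpansion

/-! ### The leading coefficient of the formal expansion -/

section Leading

variable {ι : Type*} [Fintype ι] {S : ι → ℕ → PowerSeries ℂ} {g : ι → ℕ → ℂ}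

theorem exists_prod_eq_X_pow_mul (hS : ∀ i k j, 2 * j < k → PowerSeries.coeff j (S i k) = 0)
    (e : ι → ℕ) : ∃ T : ι → PowerSeries ℂ,
      (∀ i, S i (e i) = PowerSeries.X ^ ((e i + 1) / 2) * T i) ∧
      ∏ i, S i (e i) = PowerSeries.X ^ (∑ i, (e i + 1) / 2) * ∏ i, T i := by
  have h : ∀ i, ∃ T, S i (e i) = PowerSeries.X ^ ((e i + 1) / 2) * T := fun i =>
    PowerSeries.X_pow_dvd_iff.2 fun j hj => hS i (e i) j (by omega)
  choose T hT using h
  refine ⟨T, hT, ?_⟩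
  rw [Finset.prod_congr rfl fun i _ => hT i, Finset.prod_mul_distrib, Finset.prod_pow_eq_pow_sum]

theorem coeff_prod_eq_zero (hS : ∀ i k j, 2 * j < k → PowerSeries.coeff j (S i k) = 0)
    (e : ι → ℕ) {j : ℕ} (hj : 2 * j < ∑ i, e i) :
    PowerSeries.coeff j (∏ i, S i (e i)) = 0 := by
  obtain ⟨T, -, hT⟩ := exists_prod_eq_X_pow_mul hS e
  rw [hT, PowerSeries.coeff_X_pow_mul', if_neg]
  have : ∑ i, e i ≤ ∑ i, 2 * ((e i + 1) / 2) := Finset.sum_le_sum fun i _ => by omega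
  rw [← Finset.mul_sum] at this
  omega

theorem coeff_prod_eq_prod (hS : ∀ i k j, 2 * j < k → PowerSeries.coeff j (S i k) = 0)
    (hg : ∀ i q, PowerSeries.coeff q (S i (2 * q)) = g i (2 * q))
    (hg' : ∀ i q, g i (2 * q + 1) = 0) (e : ι → ℕ) {d : ℕ} (hd : ∑ i, e i = 2 * d) :
    PowerSeries.coeff d (∏ i, S i (e i)) = ∏ i, g i (e i) := by
  obtain ⟨T, hT, hT'⟩ := exists_prod_eq_X_pow_mul hS e
  by_cases h : ∀ i, Even (e i)
  · have hsum : ∑ i, (e i + 1) / 2 = d := by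
      have : ∑ i, 2 * ((e i + 1) / 2) = ∑ i, e i := Finset.sum_congr rfl fun i _ => by
        obtain ⟨q, hq⟩ := h i
        omega
      rw [← Finset.mul_sum] at this
      omega
    rw [hT', hsum, PowerSeries.coeff_X_pow_mul', if_pos le_rfl, Nat.sub_self,
      PowerSeries.coeff_zero_eq_constantCoeff, map_prod]
    refine Finset.prod_congr rfl fun i _ => ?_
    obtain ⟨q, hq⟩ := (h i).two_dvd
    rw [hq, ← hg, ← hq, hT i, PowerSeries.coeff_X_pow_mul', if_pos (by omega),
      show q - (e i + 1) / 2 = 0 by omega, PowerSeries.coeff_zero_eq_constantCoeff]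
  · push Not at h
    obtain ⟨i, hi⟩ := h
    obtain ⟨q, hq⟩ := Nat.not_even_iff_odd.1 hi
    rw [Finset.prod_eq_zero (f := fun i => g i (e i)) (Finset.mem_univ i) (by rw [hq, hg']), hT',
      PowerSeries.coeff_X_pow_mul', if_neg]
    have : ∑ i, e i < ∑ i, 2 * ((e i + 1) / 2) :=
      Finset.sum_lt_sum (fun i _ => by omega) ⟨i, Finset.mem_univ i, by omega⟩
    rw [← Finset.mul_sum] at this
    omega

theorem coeff_momentFunctional_eq_zero
    (hS : ∀ i k j, 2 * j < k → PowerSeries.coeff j (S i k) = 0) {p : MvPolynomial ι ℂ} {j : ℕ}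
    (hp : ∀ e ∈ p.support, 2 * j < ∑ i, e i) :
    PowerSeries.coeff j (momentFunctional S p) = 0 := by
  rw [momentFunctional_apply, map_sum]
  refine Finset.sum_eq_zero fun e he => ?_
  rw [PowerSeries.coeff_smul, coeff_prod_eq_zero hS _ (hp e he), smul_zero]

theorem sum_eq_of_mem_support {Q : MvPolynomial ι ℂ} {D : ℕ} (hQ : Q.IsHomogeneous D)
    {e : ι →₀ ℕ} (he : e ∈ Q.support) : ∑ i, e i = D := by
  by_contra h
  refine MvPolynomial.mem_support_iff.1 he (hQ.coeff_eq_zero ?_)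
  rwa [Finsupp.degree_eq_sum]

/-- The moment functional of a product `Q * R` with `Q` homogeneous of degree `2 * d`, for
formal moments with `S i k = O(X ^ (k / 2))`, starts at order `d`. -/
theorem coeff_momentFunctional_mul_of_lt
    (hS : ∀ i k j, 2 * j < k → PowerSeries.coeff j (S i k) = 0) {Q : MvPolynomial ι ℂ} {d : ℕ}
    (hQ : Q.IsHomogeneous (2 * d)) (R : MvPolynomial ι ℂ) {j : ℕ} (hj : j < d) :
    PowerSeries.coeff j (momentFunctional S (Q * R)) = 0 := by
  classical
  refine coeff_momentFunctional_eq_zero hS fun e he => ?_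
  obtain ⟨e₁, h₁, e₂, h₂, rfl⟩ := Finset.mem_add.1 (MvPolynomial.support_mul _ _ he)
  have := sum_eq_of_mem_support hQ h₁
  simp only [Finsupp.add_apply, Finset.sum_add_distrib]
  omega

/-- The coefficient of order `d` only sees the leading moments and the constant term of `R`. -/
theorem coeff_momentFunctional_mul
    (hS : ∀ i k j, 2 * j < k → PowerSeries.coeff j (S i k) = 0)
    (hg : ∀ i q, PowerSeries.coeff q (S i (2 * q)) = g i (2 * q))
    (hg' : ∀ i q, g i (2 * q + 1) = 0) {Q : MvPolynomial ι ℂ} {d : ℕ}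
    (hQ : Q.IsHomogeneous (2 * d)) (R : MvPolynomial ι ℂ) :
    PowerSeries.coeff d (momentFunctional S (Q * R)) =
      MvPolynomial.constantCoeff R * momentFunctional g Q := by
  classical
  set c := MvPolynomial.constantCoeff R
  have hsplit : Q * R = c • Q + Q * (R - MvPolynomial.C c) := by
    rw [MvPolynomial.smul_eq_C_mul]; ring
  have h0 : PowerSeries.coeff d (momentFunctional S (Q * (R - MvPolynomial.C c))) = 0 := by
    refine coeff_momentFunctional_eq_zero hS fun e he => ?_
    obtain ⟨e₁, h₁, e₂, h₂, rfl⟩ := Finset.mem_add.1 (MvPolynomial.support_mul _ _ he)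
    have h3 := sum_eq_of_mem_support hQ h₁
    have h4 : 0 < ∑ i, e₂ i := by
      rw [Nat.pos_iff_ne_zero]
      intro h
      have : e₂ = 0 := by
        ext i
        exact (Finset.sum_eq_zero_iff.1 h) i (Finset.mem_univ i)
      subst this
      refine MvPolynomial.mem_support_iff.1 h₂ ?_
      simp [c, MvPolynomial.constantCoeff_eq]
    simp only [Finsupp.add_apply, Finset.sum_add_distrib]
    omega
  rw [hsplit, map_add, map_smul, map_add, h0, add_zero, PowerSeries.coeff_smul,
    momentFunctional_apply, momentFunctional_apply, map_sum]
  congr 1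
  refine Finset.sum_congr rfl fun e he => ?_
  rw [PowerSeries.coeff_smul, coeff_prod_eq_prod hS hg hg' _ (sum_eq_of_mem_support hQ he),
    smul_eq_mul]

end Leading

/-- The squared Vandermonde polynomial with `r` variables `1 + X i` near one saddle point and `m`
variables `-(1 + X i)` near the opposite one. -/
def saddlePoly (r m : ℕ) : MvPolynomial (Fin (r + m)) ℂ :=
  MvPolynomial.aeval (fun i => MvPolynomial.C ((Fin.addCases (fun _ => 1) (fun _ => -1) :
    Fin (r + m) → ℂ) i) * (1 + MvPolynomial.X i)) (vandermondePoly (r + m) ^ 2)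

/-- The factor of `saddlePoly` that is homogeneous in the displacements from the saddle points. -/
def saddleInner (r m : ℕ) : MvPolynomial (Fin (r + m)) ℂ :=
  MvPolynomial.rename (Fin.castAdd m) (vandermondePoly r ^ 2) *
    MvPolynomial.rename (Fin.natAdd r) (vandermondePoly m ^ 2)

/-- The interaction factor of `saddlePoly` between the two saddle points. -/
def saddleCross (r m : ℕ) : MvPolynomial (Fin (r + m)) ℂ :=
  (∏ i : Fin r, ∏ j : Fin m, (-(1 + MvPolynomial.X (Fin.natAdd r j)) -
    (1 + MvPolynomial.X (Fin.castAdd m i)))) ^ 2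

theorem rename_vandermondePoly_eq_det {n : ℕ} {κ : Type*} (f : Fin n → κ) :
    MvPolynomial.rename f (vandermondePoly n) =
      (Matrix.vandermonde fun i => (MvPolynomial.X (f i) : MvPolynomial κ ℂ)).det := by
  rw [vandermondePoly, AlgHom.map_det]
  congr 1
  ext i j
  simp [Matrix.vandermonde_apply]

theorem saddlePoly_eq (r m : ℕ) : saddlePoly r m = saddleInner r m * saddleCross r m := by
  have h1 : (Matrix.vandermonde fun i : Fin r =>
      (1 + MvPolynomial.X (Fin.castAdd m i) : MvPolynomial (Fin (r + m)) ℂ)).det =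
      MvPolynomial.rename (Fin.castAdd m) (vandermondePoly r) := by
    simp_rw [rename_vandermondePoly_eq_det, add_comm (1 : MvPolynomial (Fin (r + m)) ℂ)]
    exact Matrix.det_vandermonde_add _ _
  have h2 : (Matrix.vandermonde fun i : Fin m =>
      (1 + MvPolynomial.X (Fin.natAdd r i) : MvPolynomial (Fin (r + m)) ℂ)).det =
      MvPolynomial.rename (Fin.natAdd r) (vandermondePoly m) := by
    simp_rw [rename_vandermondePoly_eq_det, add_comm (1 : MvPolynomial (Fin (r + m)) ℂ)]
    exact Matrix.det_vandermonde_add _ _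
  have hsq : (((-1 : MvPolynomial (Fin (r + m)) ℂ)) ^ m.choose 2) ^ 2 = 1 := by
    rw [← pow_mul, mul_comm, pow_mul]; simp
  rw [saddlePoly, map_pow, aeval_vandermondePoly, det_vandermonde_add]
  simp only [Fin.addCases_left, Fin.addCases_right, map_one, one_mul, map_neg]
  rw [det_vandermonde_mul, h1, h2, saddleInner, saddleCross, map_pow, map_pow, mul_pow, mul_pow,
    mul_pow, hsq, one_mul]
  simp only [neg_one_mul]

theorem isHomogeneous_vandermondePoly (n : ℕ) :
    (vandermondePoly n).IsHomogeneous (n.choose 2) := by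
  rw [vandermondePoly, Matrix.det_apply]
  refine MvPolynomial.IsHomogeneous.sum _ _ _ fun σ _ => ?_
  have h : (∏ i, Matrix.vandermonde (MvPolynomial.X (R := ℂ)) (σ i) i).IsHomogeneous
      (n.choose 2) := by
    have := MvPolynomial.IsHomogeneous.prod Finset.univ
      (fun i : Fin n => Matrix.vandermonde (MvPolynomial.X (R := ℂ)) (σ i) i)
      (fun i => (i : ℕ)) (fun i _ => by
        rw [Matrix.vandermonde_apply]
        exact MvPolynomial.isHomogeneous_X_pow _ _)
    rwa [Fin.sum_univ_eq_sum_range (fun i => i), Finset.sum_range_id,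
      ← Nat.choose_two_right] at this
  rcases Int.units_eq_one_or σ.sign with hs | hs
  · simpa [hs] using h
  · simpa [hs] using h.neg

theorem isHomogeneous_saddleInner (r m : ℕ) :
    (saddleInner r m).IsHomogeneous (2 * (r.choose 2 + m.choose 2)) := by
  have h := (((isHomogeneous_vandermondePoly r).pow 2).rename_isHomogeneous (f := Fin.castAdd m)).mul
    (((isHomogeneous_vandermondePoly m).pow 2).rename_isHomogeneous (f := Fin.natAdd r))
  rw [show 2 * (r.choose 2 + m.choose 2) = r.choose 2 * 2 + m.choose 2 * 2 by ring]
  exact h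

theorem constantCoeff_saddleCross (r m : ℕ) :
    MvPolynomial.constantCoeff (saddleCross r m) = 4 ^ (r * m) := by
  simp only [saddleCross, map_pow, map_prod, map_sub, map_neg, map_add, map_one,
    MvPolynomial.constantCoeff_X, add_zero, Finset.prod_const, Finset.card_univ, Fintype.card_fin]
  rw [← pow_mul, ← pow_mul, show m * (r * 2) = 2 * (r * m) by ring, pow_mul]
  norm_num

/-- The formal series, in powers of `ε`, of the `m`-th normalized saddle point moment, when
`v ^ (-6) = κ ε`. -/
def saddleSeries (κ : ℂ) (m : ℕ) : PowerSeries ℂ :=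
  PowerSeries.mk fun j => saddleCoeff m j * κ ^ j

theorem coeff_saddleSeries_of_lt (κ : ℂ) {m j : ℕ} (h : 2 * j < m) :
    PowerSeries.coeff j (saddleSeries κ m) = 0 := by
  rw [saddleSeries, PowerSeries.coeff_mk, saddleCoeff_of_lt h, zero_mul]

theorem coeff_saddleSeries_two_mul (κ : ℂ) (q : ℕ) :
    PowerSeries.coeff q (saddleSeries κ (2 * q)) = complexGaussMoment (-(κ / 2)) (2 * q) := by
  rw [saddleSeries, PowerSeries.coeff_mk, saddleCoeff_two_mul, complexGaussMoment,
    Nat.mul_div_cancel_left _ two_pos, show -(κ / 2) = -(1 / 2) * κ by ring, mul_pow]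
  ring

/-- The formal expansion of the mixed Hankel determinant, with `κ` and `-κ` at the two saddles. -/
def hankelSeries (κ : ℂ) (r m : ℕ) : PowerSeries ℂ :=
  momentFunctional (Fin.addCases (fun _ => saddleSeries κ) (fun _ => saddleSeries (-κ)) :
    Fin (r + m) → ℕ → PowerSeries ℂ) (saddlePoly r m)

theorem coeff_hankelSeries_of_lt (κ : ℂ) (r m : ℕ) {j : ℕ} (hj : j < r.choose 2 + m.choose 2) :
    PowerSeries.coeff j (hankelSeries κ r m) = 0 := by
  rw [hankelSeries, saddlePoly_eq]
  refine coeff_momentFunctional_mul_of_lt (fun i k j h => ?_) (isHomogeneous_saddleInner r m) _ hj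
  induction i using Fin.addCases with
  | left i => rw [Fin.addCases_left, coeff_saddleSeries_of_lt _ h]
  | right i => rw [Fin.addCases_right, coeff_saddleSeries_of_lt _ h]

theorem coeff_hankelSeries (κ : ℂ) (r m : ℕ) :
    PowerSeries.coeff (r.choose 2 + m.choose 2) (hankelSeries κ r m) =
      4 ^ (r * m) * ((r.factorial * (-(κ / 2)) ^ r.choose 2 * barnesG (r + 1)) *
        (m.factorial * (κ / 2) ^ m.choose 2 * barnesG (m + 1))) := by
  rw [hankelSeries, saddlePoly_eq, coeff_momentFunctional_mul
    (g := Fin.addCases (fun _ => complexGaussMoment (-(κ / 2)))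
      (fun _ => complexGaussMoment (κ / 2))) (fun i k j h => ?_) (fun i q => ?_) (fun i q => ?_)
    (isHomogeneous_saddleInner r m), constantCoeff_saddleCross, saddleInner,
    momentFunctional_addCases, momentFunctional_complexGaussMoment,
    momentFunctional_complexGaussMoment]
  · induction i using Fin.addCases with
    | left i => rw [Fin.addCases_left, coeff_saddleSeries_of_lt _ h]
    | right i => rw [Fin.addCases_right, coeff_saddleSeries_of_lt _ h]
  · induction i using Fin.addCases with
    | left i => rw [Fin.addCases_left, Fin.addCases_left, coeff_saddleSeries_two_mul]
    | right i =>
      rw [Fin.addCases_right, Fin.addCases_right, coeff_saddleSeries_two_mul, neg_div, neg_neg]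
  · induction i using Fin.addCases with
    | left i => rw [Fin.addCases_left, complexGaussMoment, gaussMoment_odd]; simp
    | right i => rw [Fin.addCases_right, complexGaussMoment, gaussMoment_odd]; simp

/-! ### `Bi` as a combination of rotated copies of `Ai` -/

/-- The unit vector `exp (i π / 6)`, a cube root of `i`. -/
def sixthDir : ℂ := Complex.exp ((Real.pi : ℂ) * Complex.I / 6)

theorem sixthDir_ne_zero : sixthDir ≠ 0 := Complex.exp_ne_zero _

theorem sixthDir_pow_three : sixthDir ^ 3 = Complex.I := by
  refine Eq.trans ?_ Complex.exp_pi_div_two_mul_I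
  rw [sixthDir, ← Complex.exp_nat_mul]
  congr 1; push_cast; ring

theorem sixthDir_pow_six : sixthDir ^ 6 = -1 := by
  rw [show 6 = 3 * 2 by rfl, pow_mul, sixthDir_pow_three, Complex.I_sq]

theorem airyDir_eq_sixthDir : airyDir = sixthDir ^ 2 := by
  rw [airyDir, sixthDir, ← Complex.exp_nat_mul]
  congr 1; push_cast; ring

theorem airyDir'_eq_sixthDir : airyDir' = sixthDir⁻¹ ^ 2 := by
  rw [airyDir', sixthDir, ← Complex.exp_neg, ← Complex.exp_nat_mul]
  congr 1; push_cast; ring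

/-- Rotating the ray by a cube root of unity rotates the argument. -/
theorem airyRay_mul {ρ : ℂ} (hρ : ρ ^ 3 = 1) (ω z : ℂ) :
    airyRay (ρ * ω) z = ρ * airyRay ω (ρ * z) := by
  rw [airyRay, airyRay, mul_assoc]
  congr 4
  funext s
  congr 1
  rw [show (ρ * ω * (s : ℂ)) ^ 3 = ρ ^ 3 * (ω * (s : ℂ)) ^ 3 by ring, hρ]
  ring

theorem airyBi_eq (z : ℂ) :
    airyBi z = Complex.I * (sixthDir⁻¹ ^ 4 * airyAi (sixthDir⁻¹ ^ 4 * z) -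
      sixthDir ^ 4 * airyAi (sixthDir ^ 4 * z)) := by
  have h12 : sixthDir ^ 12 = 1 := by
    rw [show 12 = 6 * 2 by rfl, pow_mul, sixthDir_pow_six]; norm_num
  have hne := sixthDir_ne_zero
  have h12' : sixthDir⁻¹ ^ 12 = 1 := by rw [inv_pow, h12, inv_one]
  have e1 : airyRay (-1) z = sixthDir ^ 4 * airyRay airyDir (sixthDir ^ 4 * z) := by
    rw [← airyRay_mul (by rw [← pow_mul, h12]), airyDir_eq_sixthDir, ← pow_add, sixthDir_pow_six]
  have e2 : airyRay airyDir z = sixthDir ^ 4 * airyRay airyDir' (sixthDir ^ 4 * z) := by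
    rw [← airyRay_mul (by rw [← pow_mul, h12]), airyDir_eq_sixthDir, airyDir'_eq_sixthDir]
    congr 1; field_simp
  have e3 : airyRay (-1) z = sixthDir⁻¹ ^ 4 * airyRay airyDir' (sixthDir⁻¹ ^ 4 * z) := by
    rw [← airyRay_mul (by rw [← pow_mul, h12']), airyDir'_eq_sixthDir, ← pow_add, inv_pow,
      sixthDir_pow_six]
    norm_num
  have e4 : airyRay airyDir' z = sixthDir⁻¹ ^ 4 * airyRay airyDir (sixthDir⁻¹ ^ 4 * z) := by
    rw [← airyRay_mul (by rw [← pow_mul, h12']), airyDir_eq_sixthDir, airyDir'_eq_sixthDir]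
    congr 1; field_simp
  have hpi : (Real.pi : ℂ) ≠ 0 := by exact_mod_cast Real.pi_ne_zero
  rw [airyBi, airyAi, airyAi, e2]
  nth_rewrite 1 [e3]
  rw [e1, e4]
  have hI := Complex.I_ne_zero
  field_simp
  ring

/-! ### The derivatives of the two seed functions -/

/-- The scaling constant `2 ^ (-1/3)` of the seed function. -/
def airyScale : ℝ := (2 : ℝ) ^ (-(1 / 3) : ℝ)

/-- The `k`-th derivative of `Ai(-2^(-1/3) z)`. -/
def seedMomentAi (z : ℂ) (k : ℕ) : ℂ := iteratedDeriv k (fun z => airyAi (-(airyScale : ℂ) * z)) z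

/-- The `k`-th derivative of `Bi(-2^(-1/3) z)`. -/
def seedMomentBi (z : ℂ) (k : ℕ) : ℂ := iteratedDeriv k (fun z => airyBi (-(airyScale : ℂ) * z)) z

theorem contDiff_airyAi_mul (n : ℕ) (a : ℂ) : ContDiff ℂ n fun z => airyAi (a * z) :=
  (contDiff_airyAi.of_le le_top).comp (contDiff_const.mul contDiff_id)

theorem airyBi_mul_eq (a : ℂ) : (fun z => airyBi (a * z)) = fun z =>
    Complex.I * sixthDir⁻¹ ^ 4 * airyAi (sixthDir⁻¹ ^ 4 * a * z) -
      Complex.I * sixthDir ^ 4 * airyAi (sixthDir ^ 4 * a * z) := by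
  funext z
  rw [airyBi_eq, mul_assoc _ a z, mul_assoc _ a z]
  ring

theorem contDiff_airyBi_mul (n : ℕ) (a : ℂ) : ContDiff ℂ n fun z => airyBi (a * z) := by
  rw [airyBi_mul_eq]
  exact (contDiff_const.mul (contDiff_airyAi_mul n _)).sub
    (contDiff_const.mul (contDiff_airyAi_mul n _))

theorem iteratedDeriv_airyAi_mul (k : ℕ) (a z : ℂ) :
    iteratedDeriv k (fun z => airyAi (a * z)) z = a ^ k * iteratedDeriv k airyAi (a * z) := by
  rw [iteratedDeriv_comp_const_mul (contDiff_airyAi.of_le le_top)]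

theorem iteratedDeriv_airySeed (k : ℕ) (C₁ C₂ z : ℂ) :
    iteratedDeriv k (airySeed C₁ C₂) z = C₁ * seedMomentAi z k + C₂ * seedMomentBi z k := by
  have h : airySeed C₁ C₂ = fun z => C₁ * airyAi (-(airyScale : ℂ) * z) +
      C₂ * airyBi (-(airyScale : ℂ) * z) := rfl
  rw [h, iteratedDeriv_fun_add (contDiff_const.mul (contDiff_airyAi_mul k _)).contDiffAt
    (contDiff_const.mul (contDiff_airyBi_mul k _)).contDiffAt,
    iteratedDeriv_const_mul_field, iteratedDeriv_const_mul_field]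
  rfl

theorem seedMomentAi_eq {z v : ℂ} (hv : v ≠ 0) (hv2 : 0 < (v ^ 2).re)
    (h : v ^ 4 = -(airyScale : ℂ) * z) (k : ℕ) :
    seedMomentAi z k = Complex.exp (-(2 / 3 * v ^ 6)) / (2 * √Real.pi * v) *
      (airyScale * v ^ 2) ^ k * ∑ m ∈ Finset.range (k + 1), k.choose m * saddleMoment m v := by
  rw [seedMomentAi, iteratedDeriv_airyAi_mul, ← h, iteratedDeriv_airyAi_eq_sum k hv hv2,
    neg_pow (airyScale : ℂ), mul_pow (airyScale : ℂ)]
  have : ((-1 : ℂ) ^ k) * (-1) ^ k = 1 := by rw [← mul_pow]; simp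
  linear_combination ((airyScale : ℂ) ^ k * (Complex.exp (-(2 / 3 * v ^ 6)) /
    (2 * √Real.pi * v)) * (v ^ 2) ^ k *
      ∑ m ∈ Finset.range (k + 1), k.choose m * saddleMoment m v) * this

theorem seedMomentBi_eq {z v : ℂ} (hv : v ≠ 0) (hv2 : 0 < ((v * sixthDir) ^ 2).re)
    (hv2' : 0 < ((v * sixthDir⁻¹) ^ 2).re) (h : v ^ 4 = -(airyScale : ℂ) * z) (k : ℕ) :
    seedMomentBi z k = Complex.exp (2 / 3 * v ^ 6) / (√Real.pi * v) *
      (-(airyScale * v ^ 2)) ^ k * ∑ m ∈ Finset.range (k + 1), k.choose m *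
        ((saddleMoment m (v * sixthDir) + saddleMoment m (v * sixthDir⁻¹)) / 2) := by
  have hu := sixthDir_ne_zero
  have hu6 := sixthDir_pow_six
  have hu6' : sixthDir⁻¹ ^ 6 = -1 := by rw [inv_pow, hu6]; norm_num
  -- Since `w ^ 6 = -1`, the saddle point `v w` has the growing exponential, and the saddle value
  -- `w ^ 4 * (v w) ^ 2 = -v ^ 2` is the same for both rotations.
  have key : ∀ w : ℂ, w ≠ 0 → w ^ 6 = -1 → 0 < ((v * w) ^ 2).re →
      iteratedDeriv k (fun z => airyAi (w ^ 4 * -(airyScale : ℂ) * z)) z =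
      Complex.exp (2 / 3 * v ^ 6) / (2 * √Real.pi * (v * w)) * (-(airyScale * v ^ 2)) ^ k *
      ∑ m ∈ Finset.range (k + 1), k.choose m * saddleMoment m (v * w) := fun w hw hw6 hre => by
    rw [iteratedDeriv_airyAi_mul, show w ^ 4 * -(airyScale : ℂ) * z = (v * w) ^ 4 by
        rw [mul_pow, h]; ring, iteratedDeriv_airyAi_eq_sum k (mul_ne_zero hv hw) hre,
      show -(2 / 3 * (v * w) ^ 6) = 2 / 3 * v ^ 6 by rw [mul_pow, hw6]; ring]
    have : (w ^ 4 * -(airyScale : ℂ)) ^ k * ((-1) ^ k * ((v * w) ^ 2) ^ k) =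
        (-(airyScale * v ^ 2)) ^ k := by
      rw [← mul_pow, ← mul_pow]
      congr 1
      linear_combination (airyScale * v ^ 2 : ℂ) * hw6
    rw [← this]
    ring
  rw [seedMomentBi, airyBi_mul_eq, iteratedDeriv_fun_sub
    (contDiff_const.mul (contDiff_airyAi_mul k _)).contDiffAt
    (contDiff_const.mul (contDiff_airyAi_mul k _)).contDiffAt,
    iteratedDeriv_const_mul_field, iteratedDeriv_const_mul_field, key _ hu hu6 hv2,
    key _ (inv_ne_zero hu) hu6' hv2']
  have hsum : ∑ m ∈ Finset.range (k + 1), (k.choose m : ℂ) *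
        ((saddleMoment m (v * sixthDir) + saddleMoment m (v * sixthDir⁻¹)) / 2) =
      ((∑ m ∈ Finset.range (k + 1), k.choose m * saddleMoment m (v * sixthDir)) +
        ∑ m ∈ Finset.range (k + 1), k.choose m * saddleMoment m (v * sixthDir⁻¹)) / 2 := by
    rw [← Finset.sum_add_distrib, Finset.sum_div]
    exact Finset.sum_congr rfl fun m _ => by ring
  rw [hsum]
  generalize (∑ m ∈ Finset.range (k + 1), (k.choose m : ℂ) * saddleMoment m (v * sixthDir)) = X
  generalize (∑ m ∈ Finset.range (k + 1), (k.choose m : ℂ) * saddleMoment m (v * sixthDir⁻¹)) = Y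
  have hpi : (√Real.pi : ℂ) ≠ 0 := by
    exact_mod_cast (Real.sqrt_pos.2 Real.pi_pos).ne'
  have hI : Complex.I * sixthDir ^ 4 / sixthDir = -1 := by
    rw [div_eq_iff hu, show sixthDir ^ 4 = sixthDir ^ 3 * sixthDir by ring, sixthDir_pow_three]
    linear_combination sixthDir * Complex.I_sq
  have hI' : Complex.I * sixthDir⁻¹ ^ 4 / sixthDir⁻¹ = 1 := by
    rw [div_eq_iff (inv_ne_zero hu), show sixthDir⁻¹ ^ 4 = sixthDir⁻¹ ^ 3 * sixthDir⁻¹ by ring,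
      inv_pow _ 3, sixthDir_pow_three, ← mul_assoc, mul_inv_cancel₀ Complex.I_ne_zero]
  have e : ∀ w W : ℂ, Complex.I * w ^ 4 * (Complex.exp (2 / 3 * v ^ 6) / (2 * √Real.pi * (v * w)) *
      (-(airyScale * v ^ 2)) ^ k * W) = (Complex.I * w ^ 4 / w) *
        (Complex.exp (2 / 3 * v ^ 6) / (2 * √Real.pi * v) * (-(airyScale * v ^ 2)) ^ k * W) :=
    fun w W => by
      simp only [div_eq_mul_inv, mul_inv]; ring
  rw [e, e, hI, hI']
  field_simp
  ring

/-- Evaluation of the mixed Hankel determinant through the moments about the saddle points. -/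
theorem mixedHankel_eq {μ₁ μ₂ H₁ H₂ : ℕ → ℂ} {P₁ P₂ R : ℂ} (r m : ℕ)
    (h₁ : ∀ k, μ₁ k = P₁ * R ^ k * ∑ i ∈ Finset.range (k + 1), k.choose i * H₁ i)
    (h₂ : m ≠ 0 → ∀ k, μ₂ k = P₂ * (-R) ^ k * ∑ i ∈ Finset.range (k + 1), k.choose i * H₂ i) :
    mixedHankel r m μ₁ μ₂ = P₁ ^ r * P₂ ^ m * R ^ (2 * (r + m).choose 2) *
      momentFunctional (Fin.addCases (fun _ => H₁) (fun _ => H₂) : Fin (r + m) → ℕ → ℂ)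
        (saddlePoly r m) / (r.factorial * m.factorial) := by
  have h := momentFunctional_eq_aeval
    (ν := (Fin.addCases (fun _ => H₁) (fun _ => H₂) : Fin (r + m) → ℕ → ℂ))
    (μ := (Fin.addCases (fun _ => μ₁) (fun _ => μ₂) : Fin (r + m) → ℕ → ℂ))
    (P := Fin.addCases (fun _ => P₁) (fun _ => P₂))
    (ρ := fun i => R * (Fin.addCases (fun _ => 1) (fun _ => -1) : Fin (r + m) → ℂ) i)
    (fun i k => by
      induction i using Fin.addCases with
      | left i => simpa using h₁ k
      | right i => simpa using h₂ (Nat.pos_iff_ne_zero.1 i.pos) k) (vandermondePoly (r + m) ^ 2)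
  have h3 : MvPolynomial.aeval (fun i => MvPolynomial.C
      (R * (Fin.addCases (fun _ => 1) (fun _ => -1) : Fin (r + m) → ℂ) i) *
        (1 + MvPolynomial.X i)) (vandermondePoly (r + m) ^ 2) =
      (R ^ (2 * (r + m).choose 2)) • saddlePoly r m := by
    rw [saddlePoly, map_pow, map_pow, aeval_vandermondePoly, aeval_vandermondePoly]
    simp_rw [map_mul, mul_assoc]
    rw [det_vandermonde_mul, MvPolynomial.smul_eq_C_mul, mul_pow, ← pow_mul, map_pow,
      mul_comm 2 ((r + m).choose 2)]
  rw [mixedHankel, h, h3, map_smul, Fin.prod_univ_add]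
  simp only [Fin.addCases_left, Fin.addCases_right, Finset.prod_const, Finset.card_univ,
    Fintype.card_fin, smul_eq_mul]
  ring

/-! ### Expansions in sectors -/

/-- The fourth root `(-z) ^ (1 / 4)`. -/
def quarterRoot (z : ℂ) : ℂ := Complex.exp (Complex.log (-z) / 4)

/-- The gauge `(-z) ^ (-3 / 2)`. -/
def airyGauge (z : ℂ) : ℂ := (quarterRoot z ^ 6)⁻¹

/-- The scaling constant `2 ^ (-1 / 12)`, the fourth root of `airyScale`. -/
def rootScale : ℝ := (2 : ℝ) ^ (-(1 / 12) : ℝ)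

theorem rootScale_pos : 0 < rootScale := Real.rpow_pos_of_pos two_pos _

theorem rootScale_pow_four : rootScale ^ 4 = airyScale := by
  rw [rootScale, airyScale, ← Real.rpow_mul_natCast two_pos.le]
  norm_num

theorem rootScale_pow_six : rootScale ^ 6 * √2 = 1 := by
  rw [rootScale, ← Real.rpow_mul_natCast two_pos.le, Real.sqrt_eq_rpow, ← Real.rpow_add two_pos]
  norm_num

theorem quarterRoot_ne_zero (z : ℂ) : quarterRoot z ≠ 0 := Complex.exp_ne_zero _

theorem airyGauge_ne_zero (z : ℂ) : airyGauge z ≠ 0 :=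
  inv_ne_zero (pow_ne_zero _ (quarterRoot_ne_zero z))

theorem cpow_eq_quarterRoot_pow {z : ℂ} (hz : z ≠ 0) {s : ℂ} {k : ℕ} (hs : s = k / 4) :
    (-z) ^ s = quarterRoot z ^ k := by
  rw [Complex.cpow_def_of_ne_zero (neg_ne_zero.2 hz), quarterRoot, ← Complex.exp_nat_mul, hs]
  congr 1; ring

theorem quarterRoot_pow_four {z : ℂ} (hz : z ≠ 0) : quarterRoot z ^ 4 = -z := by
  rw [← cpow_eq_quarterRoot_pow hz (s := 1) (by norm_num), Complex.cpow_one]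

/-- The point `v`, with `v ^ 4 = -2 ^ (-1/3) z`, rotated by the angle `φ`: up to the scaling of
`Ai`, the saddle point of the Airy phase is `v ^ 2`. -/
def saddleRoot (φ : ℝ) (z : ℂ) : ℂ := rootScale * quarterRoot z * Complex.exp (φ * Complex.I)

theorem saddleRoot_zero (z : ℂ) : saddleRoot 0 z = rootScale * quarterRoot z := by
  simp [saddleRoot]

theorem saddleRoot_eq_polar (φ : ℝ) (z : ℂ) :
    saddleRoot φ z = ((rootScale * Real.exp (Real.log ‖z‖ / 4) : ℝ) : ℂ) *
      Complex.exp (((Complex.arg (-z) / 4 + φ : ℝ) : ℂ) * Complex.I) := by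
  have h : Complex.log (-z) / 4 = ((Real.log ‖z‖ / 4 : ℝ) : ℂ) +
      ((Complex.arg (-z) / 4 : ℝ) : ℂ) * Complex.I := by
    rw [Complex.log, norm_neg]; push_cast; ring
  rw [saddleRoot, quarterRoot, h, Complex.exp_add, Complex.ofReal_mul, Complex.ofReal_exp,
    Complex.ofReal_add, add_mul, Complex.exp_add]
  ring

theorem norm_saddleRoot (φ : ℝ) (z : ℂ) :
    ‖saddleRoot φ z‖ = rootScale * Real.exp (Real.log ‖z‖ / 4) := by
  have := rootScale_pos
  rw [saddleRoot_eq_polar, norm_mul, Complex.norm_exp_ofReal_mul_I, mul_one, Complex.norm_real,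
    Real.norm_of_nonneg (by positivity)]

theorem saddleRoot_re (φ : ℝ) (z : ℂ) :
    (saddleRoot φ z).re = ‖saddleRoot φ z‖ * Real.cos (Complex.arg (-z) / 4 + φ) := by
  rw [norm_saddleRoot, saddleRoot_eq_polar, Complex.re_ofReal_mul, Complex.exp_ofReal_mul_I_re]

theorem saddleRoot_sq_re (φ : ℝ) (z : ℂ) :
    (saddleRoot φ z ^ 2).re =
      ‖saddleRoot φ z‖ ^ 2 * Real.cos (Complex.arg (-z) / 2 + 2 * φ) := by
  rw [norm_saddleRoot, saddleRoot_eq_polar, mul_pow, ← Complex.exp_nat_mul, ← Complex.ofReal_pow,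
    Complex.re_ofReal_mul, show ((2 : ℕ) : ℂ) * (((Complex.arg (-z) / 4 + φ : ℝ) : ℂ) * Complex.I) =
      ((Complex.arg (-z) / 2 + 2 * φ : ℝ) : ℂ) * Complex.I by push_cast; ring,
    Complex.exp_ofReal_mul_I_re]

theorem norm_saddleRoot_pos (φ : ℝ) (z : ℂ) : 0 < ‖saddleRoot φ z‖ := by
  have := rootScale_pos
  rw [norm_saddleRoot]; positivity

theorem saddleRoot_sq_re_pos {φ : ℝ} {z : ℂ}
    (h : |Complex.arg (-z) / 2 + 2 * φ| < Real.pi / 2) : 0 < (saddleRoot φ z ^ 2).re := by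
  rw [saddleRoot_sq_re]
  exact mul_pos (pow_pos (norm_saddleRoot_pos φ z) 2) (Real.cos_pos_of_mem_Ioo (abs_lt.1 h))

theorem saddleRoot_pi_div_six (z : ℂ) :
    saddleRoot (Real.pi / 6) z = saddleRoot 0 z * sixthDir := by
  rw [saddleRoot_zero, saddleRoot, sixthDir]
  congr 2; push_cast; ring

theorem saddleRoot_neg_pi_div_six (z : ℂ) :
    saddleRoot (-(Real.pi / 6)) z = saddleRoot 0 z * sixthDir⁻¹ := by
  rw [saddleRoot_zero, saddleRoot, sixthDir, ← Complex.exp_neg]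
  congr 2; push_cast; ring

theorem inv_saddleRoot_pow_six (φ : ℝ) (z : ℂ) :
    (saddleRoot φ z ^ 6)⁻¹ =
      (√2 * Complex.exp (-(6 * φ * Complex.I))) * airyGauge z := by
  have h : (rootScale : ℂ) ^ 6 * (√2 : ℂ) = 1 := by exact_mod_cast rootScale_pow_six
  rw [saddleRoot, airyGauge, mul_pow, mul_pow, ← Complex.exp_nat_mul, Complex.exp_neg,
    eq_inv_of_mul_eq_one_right h]
  have := quarterRoot_ne_zero z
  have h2 := Complex.exp_ne_zero (6 * φ * Complex.I)
  push_cast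
  rw [show (6 : ℂ) * (φ * Complex.I) = 6 * φ * Complex.I by ring]
  simp only [mul_inv]
  ring

theorem tendsto_norm_saddleRoot (φ : ℝ) :
    Tendsto (fun z => ‖saddleRoot φ z‖) (cobounded ℂ) atTop := by
  simp_rw [norm_saddleRoot]
  refine Tendsto.const_mul_atTop rootScale_pos (Real.tendsto_exp_atTop.comp ?_)
  exact (Real.tendsto_log_atTop.comp tendsto_norm_cobounded_atTop).atTop_div_const (by norm_num)

theorem airyGauge_isBigO_one {l : Filter ℂ} (hl : l ≤ cobounded ℂ) :
    airyGauge =O[l] fun _ => (1 : ℂ) := by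
  refine IsBigO.of_bound 1 ?_
  filter_upwards [hl ((tendsto_norm_saddleRoot 0).eventually_ge_atTop 1)] with z hz
  have h2 := inv_saddleRoot_pow_six 0 z
  have h3 : ‖airyGauge z‖ * √2 = (‖saddleRoot 0 z‖ ^ 6)⁻¹ := by
    rw [← norm_pow, ← norm_inv, h2, norm_mul, norm_mul, Complex.norm_real,
      Real.norm_of_nonneg (Real.sqrt_nonneg _)]
    simp [mul_comm]
  have h4 : (‖saddleRoot 0 z‖ ^ 6)⁻¹ ≤ 1 := inv_le_one_of_one_le₀ (one_le_pow₀ hz)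
  have h5 : (1 : ℝ) ≤ √2 := Real.one_le_sqrt.2 (by norm_num)
  rw [norm_one, mul_one]
  nlinarith [norm_nonneg (airyGauge z)]

theorem eval_trunc_saddleSeries (κ x : ℂ) (m N : ℕ) :
    ((saddleSeries κ m).trunc N).eval x =
      ∑ j ∈ Finset.range N, saddleCoeff m j * (κ * x) ^ j := by
  rw [← Polynomial.eval₂_id, PowerSeries.eval₂_trunc_eq_sum_range]
  refine Finset.sum_congr rfl fun j _ => ?_
  rw [saddleSeries, PowerSeries.coeff_mk, RingHom.id_apply, mul_pow, mul_assoc]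

/-- Expansion of the saddle point moments as long as `arg v ^ 2` stays away from `±π / 2`. -/
theorem hasGaugeExpansion_saddleMoment {l : Filter ℂ} (hl : l ≤ cobounded ℂ) (φ : ℝ) {η : ℝ}
    (hη : 0 < η)
    (harg : ∀ᶠ z in l, |Complex.arg (-z) / 2 + 2 * φ| ≤ Real.pi / 2 - η) (m : ℕ) :
    HasGaugeExpansion l airyGauge (fun z => saddleMoment m (saddleRoot φ z))
      (saddleSeries (√2 * Complex.exp (-(6 * φ * Complex.I))) m) := by
  intro N
  -- `κ = √(sin η')` bounds `Re (v ^ 2) / ‖v‖ ^ 2` below; `η` is capped to keep the sine positive.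
  set η' := min η (Real.pi / 2)
  have hη' : 0 < η' := lt_min hη (by positivity)
  have hη2 : η' ≤ Real.pi / 2 := min_le_right _ _
  have hsin : 0 < Real.sin η' := Real.sin_pos_of_pos_of_lt_pi hη' (by linarith [Real.pi_pos])
  obtain ⟨C, hC0, hC⟩ := exists_norm_saddleMoment_sub_sum_le m N (Real.sqrt_pos.2 hsin)
  refine IsBigO.of_bound (C * √2 ^ N) ?_
  filter_upwards [harg, hl ((tendsto_norm_saddleRoot φ).eventually_ge_atTop 1)] with z hz h1
  have hz' : |Complex.arg (-z) / 2 + 2 * φ| ≤ Real.pi / 2 - η' :=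
    hz.trans (by linarith [min_le_left η (Real.pi / 2)])
  have hpos := norm_saddleRoot_pos φ z
  have hre : 0 < (saddleRoot φ z).re := by
    rw [saddleRoot_re]
    refine mul_pos hpos (Real.cos_pos_of_mem_Ioo (abs_lt.1 ?_))
    have : |Complex.arg (-z) / 4 + φ| = |Complex.arg (-z) / 2 + 2 * φ| / 2 := by
      rw [← abs_of_pos (two_pos : (0 : ℝ) < 2), ← abs_div, abs_of_pos (two_pos : (0 : ℝ) < 2)]
      congr 1; ring
    rw [this]
    linarith [Real.pi_pos]
  have hcos : √(Real.sin η') ^ 2 * ‖saddleRoot φ z‖ ^ 2 ≤ (saddleRoot φ z ^ 2).re := by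
    rw [saddleRoot_sq_re, Real.sq_sqrt hsin.le, mul_comm]
    gcongr
    rw [← Real.cos_abs (Complex.arg (-z) / 2 + 2 * φ), ← Real.cos_pi_div_two_sub]
    exact Real.cos_le_cos_of_nonneg_of_le_pi (abs_nonneg _) (by linarith [Real.pi_pos]) hz'
  have h := hC _ hre hcos h1
  rw [eval_trunc_saddleSeries, ← inv_saddleRoot_pow_six]
  refine h.trans (le_of_eq ?_)
  rw [← norm_pow, ← norm_inv, inv_saddleRoot_pow_six, norm_mul, norm_mul,
    Complex.norm_real, Real.norm_of_nonneg (Real.sqrt_nonneg _), norm_pow, mul_pow]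
  have : ‖Complex.exp (-(6 * φ * Complex.I))‖ = 1 := by
    rw [show -(6 * (φ : ℂ) * Complex.I) = ((-(6 * φ) : ℝ) : ℂ) * Complex.I by push_cast; ring,
      Complex.norm_exp_ofReal_mul_I]
  rw [this, mul_one, mul_assoc]

/-- The normalized moments of the functional attached to `Bi`: both rotated copies of `Ai`
contribute one half. -/
def saddleMomentBi (z : ℂ) (k : ℕ) : ℂ :=
  (saddleMoment k (saddleRoot (Real.pi / 6) z) + saddleMoment k (saddleRoot (-(Real.pi / 6)) z)) / 2

theorem hasGaugeExpansion_saddleMomentBi {l : Filter ℂ} (hl : l ≤ cobounded ℂ) {δ : ℝ}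
    (hδ : 0 < δ) (harg : ∀ᶠ z in l, |Complex.arg (-z)| ≤ Real.pi / 3 - δ) (k : ℕ) :
    HasGaugeExpansion l airyGauge (fun z => saddleMomentBi z k) (saddleSeries (-√2) k) := by
  have e1 : Complex.exp (-(6 * ((Real.pi / 6 : ℝ) : ℂ) * Complex.I)) = -1 := by
    rw [← Complex.exp_neg_pi_mul_I]; congr 1; push_cast; ring
  have e2 : Complex.exp (-(6 * ((-(Real.pi / 6) : ℝ) : ℂ) * Complex.I)) = -1 := by
    rw [← Complex.exp_pi_mul_I]; congr 1; push_cast; ring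
  have h1 := hasGaugeExpansion_saddleMoment hl (Real.pi / 6) (half_pos hδ) (harg.mono fun z hz => by
    rw [abs_le] at hz ⊢; constructor <;> linarith [hz.1, hz.2]) k
  have h2 := hasGaugeExpansion_saddleMoment hl (-(Real.pi / 6)) (half_pos hδ)
    (harg.mono fun z hz => by rw [abs_le] at hz ⊢; constructor <;> linarith [hz.1, hz.2]) k
  rw [e1, mul_neg_one] at h1
  rw [e2, mul_neg_one] at h2
  have h3 := (h1.add h2).const_smul (1 / 2)
  have e3 : (1 / 2 : ℂ) • (saddleSeries (-√2) k + saddleSeries (-√2) k) =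
      saddleSeries (-√2) k := by
    rw [← two_smul ℂ, smul_smul]; norm_num
  rw [e3] at h3
  refine h3.congr' (Eventually.of_forall fun z => ?_)
  simp only [saddleMomentBi, smul_eq_mul]
  ring

/-- The mixed Hankel determinant with all elementary factors removed. -/
def normalizedHankel (r m : ℕ) (z : ℂ) : ℂ :=
  momentFunctional (Fin.addCases (fun _ k => saddleMoment k (saddleRoot 0 z))
    (fun _ => saddleMomentBi z) : Fin (r + m) → ℕ → ℂ) (saddlePoly r m)

/-- If no variable is attached to `Bi`, the expansion holds in the sector of `Ai`. -/
theorem hasGaugeExpansion_normalizedHankel {l : Filter ℂ} (hl : l ≤ cobounded ℂ) (r m : ℕ) {δ : ℝ}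
    (hδ : 0 < δ) (harg : ∀ᶠ z in l, |Complex.arg (-z)| ≤ Real.pi - δ)
    (harg' : m ≠ 0 → ∀ᶠ z in l, |Complex.arg (-z)| ≤ Real.pi / 3 - δ) :
    HasGaugeExpansion l airyGauge (normalizedHankel r m) (hankelSeries √2 r m) := by
  have h := HasGaugeExpansion.momentFunctional (airyGauge_isBigO_one hl)
    (H := fun i k z => (Fin.addCases (fun _ k => saddleMoment k (saddleRoot 0 z))
      (fun _ => saddleMomentBi z) : Fin (r + m) → ℕ → ℂ) i k)
    (S := Fin.addCases (fun _ => saddleSeries √2) (fun _ => saddleSeries (-√2)))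
    (fun i k => ?_) (saddlePoly r m)
  · exact h
  · induction i using Fin.addCases with
    | left i =>
      simp only [Fin.addCases_left]
      have h1 := hasGaugeExpansion_saddleMoment hl 0 (half_pos hδ) (harg.mono fun z hz => by
        rw [abs_le] at hz ⊢; constructor <;> linarith [hz.1, hz.2]) k
      simpa using h1
    | right i =>
      simp only [Fin.addCases_right]
      exact hasGaugeExpansion_saddleMomentBi hl hδ (harg' (Nat.pos_iff_ne_zero.1 i.pos)) k

/-- The exact relation between the mixed Hankel determinants and their normalized versions. -/
theorem mixedHankel_seed {z : ℂ} (hz : z ≠ 0) (r m : ℕ) (harg : |Complex.arg (-z)| < Real.pi)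
    (harg' : m ≠ 0 → |Complex.arg (-z)| < Real.pi / 3) :
    mixedHankel r m (seedMomentAi z) (seedMomentBi z) =
      (Complex.exp (-(√2 / 3 * quarterRoot z ^ 6)) /
        (2 * √Real.pi * (rootScale * quarterRoot z))) ^ r *
      (Complex.exp (√2 / 3 * quarterRoot z ^ 6) / (√Real.pi * (rootScale * quarterRoot z))) ^ m *
      (quarterRoot z ^ 2 / √2) ^ (2 * (r + m).choose 2) *
      normalizedHankel r m z / (r.factorial * m.factorial) := by
  set v := saddleRoot 0 z
  have hv : v ≠ 0 := norm_pos_iff.1 (norm_saddleRoot_pos 0 z)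
  have hv1 : v = rootScale * quarterRoot z := saddleRoot_zero z
  have hs2 : (√2 : ℂ) * √2 = 2 := by exact_mod_cast Real.mul_self_sqrt two_pos.le
  have hs0 : (√2 : ℂ) ≠ 0 := fun h => by simp [h] at hs2
  have h6 : (rootScale : ℂ) ^ 6 * (√2 : ℂ) = 1 := by exact_mod_cast rootScale_pow_six
  have h4 : (rootScale : ℂ) ^ 4 = airyScale := by exact_mod_cast rootScale_pow_four
  have hv4 : v ^ 4 = -(airyScale : ℂ) * z := by
    rw [hv1, mul_pow, h4, quarterRoot_pow_four hz]; ring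
  have hv6 : 2 / 3 * v ^ 6 = √2 / 3 * quarterRoot z ^ 6 := by
    rw [hv1, mul_pow]
    linear_combination (√2 / 3 * quarterRoot z ^ 6 : ℂ) * h6 -
      (rootScale : ℂ) ^ 6 / 3 * quarterRoot z ^ 6 * hs2
  have hR : (airyScale : ℂ) * v ^ 2 = quarterRoot z ^ 2 / √2 := by
    rw [eq_div_iff hs0, hv1, ← h4]
    linear_combination quarterRoot z ^ 2 * h6
  have hre : 0 < (v ^ 2).re := saddleRoot_sq_re_pos (by
    rw [abs_lt] at harg ⊢; constructor <;> linarith [harg.1, harg.2])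
  rw [normalizedHankel, ← hv6, ← hv1]
  refine mixedHankel_eq r m (fun k => ?_) (fun hm k => ?_)
  · rw [seedMomentAi_eq hv hre hv4, hR]
  · have h3 := abs_lt.1 (harg' hm)
    have hre1 : 0 < ((v * sixthDir) ^ 2).re := by
      rw [← saddleRoot_pi_div_six]
      exact saddleRoot_sq_re_pos (abs_lt.2 (by constructor <;> linarith [h3.1, h3.2]))
    have hre2 : 0 < ((v * sixthDir⁻¹) ^ 2).re := by
      rw [← saddleRoot_neg_pi_div_six]
      exact saddleRoot_sq_re_pos (abs_lt.2 (by constructor <;> linarith [h3.1, h3.2]))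
    rw [seedMomentBi_eq hv hre1 hre2 hv4, hR]
    simp only [saddleMomentBi, saddleRoot_pi_div_six, saddleRoot_neg_pi_div_six, v]

/-! ### The amplitudes of the exponentials in the tau function -/

/-- The amplitude, in the `(r + m) × (r + m)` determinant, of the exponential that carries
`r` factors `Ai` and `m` factors `Bi`. -/
def tauAmplitude (r m : ℕ) (z : ℂ) : ℂ :=
  mixedHankel r m (seedMomentAi z) (seedMomentBi z) /
    ((tauConst (r + m) : ℂ) * (-z) ^ (-(((r + m : ℕ) : ℂ) ^ 2 / 4)) *
      Complex.exp ((√2 : ℂ) / 3 * ((m : ℂ) - r) * (-z) ^ (3 / 2 : ℂ)))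

/-- The numerical factor between `tauAmplitude` and `normalizedHankel`. -/
def tauFactor (r m : ℕ) : ℂ :=
  1 / (2 ^ r * (√Real.pi : ℂ) ^ (r + m) * (rootScale : ℂ) ^ (r + m) * 2 ^ (r + m).choose 2 *
    (r.factorial * m.factorial) * (tauConst (r + m) : ℂ))

/-- The coefficients of the expansion of `tauAmplitude`; the formal series of the normalized
determinant starts at order `r.choose 2 + m.choose 2`. -/
def tauCoeff (r m j : ℕ) : ℂ :=
  tauFactor r m * PowerSeries.coeff (r.choose 2 + m.choose 2 + j) (hankelSeries √2 r m)

theorem tauConst_pos (n : ℕ) : 0 < tauConst n :=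
  div_pos (Real.rpow_pos_of_pos two_pos _) (Real.rpow_pos_of_pos Real.pi_pos _)

theorem choose_two_add (r m : ℕ) :
    (r + m).choose 2 = r.choose 2 + m.choose 2 + r * m := by
  have h : (((r + m).choose 2 : ℕ) : ℚ) = ((r.choose 2 + m.choose 2 + r * m : ℕ) : ℚ) := by
    push_cast [Nat.cast_choose_two]
    ring
  exact_mod_cast h

theorem two_mul_choose_two_add (n : ℕ) : 2 * n.choose 2 + n = n ^ 2 := by
  have h : ((2 * n.choose 2 + n : ℕ) : ℚ) = ((n ^ 2 : ℕ) : ℚ) := by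
    push_cast [Nat.cast_choose_two]
    ring
  exact_mod_cast h

theorem tauAmplitude_eq {z : ℂ} (hz : z ≠ 0) (r m : ℕ) (harg : |Complex.arg (-z)| < Real.pi)
    (harg' : m ≠ 0 → |Complex.arg (-z)| < Real.pi / 3) :
    tauAmplitude r m z = tauFactor r m * quarterRoot z ^ (6 * (r * m)) *
      (normalizedHankel r m z / airyGauge z ^ (r.choose 2 + m.choose 2)) := by
  have hq := quarterRoot_ne_zero z
  have hpi : (√Real.pi : ℂ) ≠ 0 := by
    exact_mod_cast (Real.sqrt_pos.2 Real.pi_pos).ne'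
  have hγ : (rootScale : ℂ) ≠ 0 := by exact_mod_cast rootScale_pos.ne'
  have hK : (tauConst (r + m) : ℂ) ≠ 0 := by exact_mod_cast (tauConst_pos _).ne'
  have hr : (r.factorial : ℂ) ≠ 0 := by exact_mod_cast r.factorial_ne_zero
  have hm : (m.factorial : ℂ) ≠ 0 := by exact_mod_cast m.factorial_ne_zero
  have hs2 : (√2 : ℂ) ^ 2 = 2 := by exact_mod_cast Real.sq_sqrt two_pos.le
  rw [tauAmplitude, mixedHankel_seed hz r m harg harg', Complex.cpow_neg,
    cpow_eq_quarterRoot_pow hz (s := ((r + m : ℕ) : ℂ) ^ 2 / 4) (k := (r + m) ^ 2)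
      (by push_cast; ring),
    cpow_eq_quarterRoot_pow hz (s := 3 / 2) (k := 6) (by norm_num)]
  have hexp : Complex.exp ((√2 : ℂ) / 3 * ((m : ℂ) - r) * quarterRoot z ^ 6) =
      Complex.exp (-(√2 / 3 * quarterRoot z ^ 6)) ^ r *
        Complex.exp (√2 / 3 * quarterRoot z ^ 6) ^ m := by
    rw [← Complex.exp_nat_mul, ← Complex.exp_nat_mul, ← Complex.exp_add]
    congr 1; ring
  have hE₁ := Complex.exp_ne_zero (-(√2 / 3 * quarterRoot z ^ 6))
  have hE₂ := Complex.exp_ne_zero (√2 / 3 * quarterRoot z ^ 6)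
  have hpow : (quarterRoot z ^ 2 / √2) ^ (2 * (r + m).choose 2) =
      quarterRoot z ^ (4 * (r + m).choose 2) / 2 ^ (r + m).choose 2 := by
    rw [div_pow, ← pow_mul, pow_mul (√2 : ℂ), hs2]
    congr 2; ring
  -- The net power of `(-z) ^ (1 / 4)`: scaling of the squared Vandermonde polynomial, prefactors
  -- of the moments, and the leading power of the gauge.
  have hcount : quarterRoot z ^ (4 * (r + m).choose 2) * quarterRoot z ^ (r + m) ^ 2 =
      quarterRoot z ^ (6 * (r * m)) * (quarterRoot z ^ 6) ^ (r.choose 2 + m.choose 2) *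
        (quarterRoot z ^ r * quarterRoot z ^ m) := by
    rw [← pow_mul, ← pow_add, ← pow_add, ← pow_add, ← pow_add]
    congr 1
    have h1 := choose_two_add r m
    have h2 := two_mul_choose_two_add (r + m)
    omega
  rw [hexp, hpow, tauFactor, airyGauge, inv_pow, div_inv_eq_mul]
  generalize normalizedHankel r m z = X
  generalize Complex.exp (-(√2 / 3 * quarterRoot z ^ 6)) = E₁ at *
  generalize Complex.exp (√2 / 3 * quarterRoot z ^ 6) = E₂ at *
  rw [div_pow, div_pow, mul_pow, mul_pow, mul_pow, mul_pow, mul_pow, pow_add (√Real.pi : ℂ),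
    pow_add (rootScale : ℂ)]
  field_simp
  linear_combination X * hcount

/-- The Poincaré expansion of the amplitudes. -/
theorem hasSectorExpansion_tauAmplitude (r m : ℕ) {θ : ℝ} (hθ : θ ≤ Real.pi)
    (hθ' : m ≠ 0 → θ ≤ Real.pi / 3) (c : ℂ) {p : ℂ} (hp : p = 3 / 2 * (r : ℂ) * (m : ℂ)) :
    HasSectorExpansion θ (fun z => c * tauAmplitude r m z) p (fun j => c * tauCoeff r m j) := by
  intro δ hδ N
  set l := cobounded ℂ ⊓ 𝓟 {z : ℂ | |Complex.arg (-z)| ≤ θ - δ}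
  have hl : l ≤ cobounded ℂ := inf_le_left
  have hmem : ∀ᶠ z in l, |Complex.arg (-z)| ≤ θ - δ :=
    mem_inf_of_right (mem_principal_self _)
  have hne : ∀ᶠ z in l, z ≠ 0 := hl (eventually_ne_cobounded 0)
  have h := ((hasGaugeExpansion_normalizedHankel hl r m hδ (hmem.mono fun z hz => by linarith)
    (fun hm => hmem.mono fun z hz => by linarith [hθ' hm])).div_pow
    (Eventually.of_forall airyGauge_ne_zero)
    (fun j hj => coeff_hankelSeries_of_lt √2 r m hj)) N
  have h2 := (isBigO_refl (fun z => quarterRoot z ^ (6 * (r * m))) l).mul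
    (h.const_mul_left (c * tauFactor r m))
  refine h2.congr' ?_ ?_
  · filter_upwards [hmem, hne] with z hz hz0
    rw [tauAmplitude_eq hz0 r m (by linarith) (fun hm => by linarith [hθ' hm]),
      cpow_eq_quarterRoot_pow hz0 (k := 6 * (r * m)) (by rw [hp]; push_cast; ring),
      ← Polynomial.eval₂_id, PowerSeries.eval₂_trunc_eq_sum_range]
    have hsum : ∑ j ∈ Finset.range N, c * tauCoeff r m j / (-z) ^ (3 * (j : ℂ) / 2) =
        c * tauFactor r m * ∑ j ∈ Finset.range N, (RingHom.id ℂ) (PowerSeries.coeff j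
          (PowerSeries.mk fun j => PowerSeries.coeff (r.choose 2 + m.choose 2 + j)
            (hankelSeries √2 r m))) * airyGauge z ^ j := by
      rw [Finset.mul_sum]
      refine Finset.sum_congr rfl fun j _ => ?_
      rw [cpow_eq_quarterRoot_pow hz0 (k := 6 * j) (by push_cast; ring), PowerSeries.coeff_mk,
        RingHom.id_apply, tauCoeff, airyGauge, inv_pow, ← pow_mul]
      ring
    rw [hsum]
    ring
  · filter_upwards [hne] with z hz0
    rw [Complex.cpow_sub _ _ (neg_ne_zero.2 hz0),
      cpow_eq_quarterRoot_pow hz0 (k := 6 * (r * m)) (by rw [hp]; push_cast; ring),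
      cpow_eq_quarterRoot_pow hz0 (s := 3 * (N : ℂ) / 2) (k := 6 * N) (by push_cast; ring),
      airyGauge, inv_pow, ← pow_mul, div_eq_mul_inv]

theorem neg_one_pow_choose_two (r : ℕ) : (-1 : ℂ) ^ r.choose 2 = (-1) ^ (r / 2) := by
  induction r using Nat.twoStepInduction with
  | zero => simp
  | one => simp
  | more r ih _ =>
    rw [choose_two_add, Nat.choose_self, show (r + 2) / 2 = r / 2 + 1 by omega, pow_add, pow_add,
      pow_mul', ih, pow_succ]
    simp [pow_succ]

/-- The powers of `2` and `π` in the leading coefficient. -/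
theorem two_pow_identity (r m : ℕ) :
    4 ^ (r * m) * (√2 / 2) ^ (r.choose 2 + m.choose 2) =
      (2 : ℝ) ^ ((m : ℝ) * (5 * r / 2 + 1)) * (2 ^ r * √Real.pi ^ (r + m) * rootScale ^ (r + m) *
        2 ^ (r + m).choose 2 * tauConst (r + m)) := by
  have hpi : √Real.pi ^ (r + m) = Real.pi ^ (((r + m : ℕ) : ℝ) / 2) := by
    rw [Real.sqrt_eq_rpow, ← Real.rpow_mul_natCast Real.pi_pos.le]
    congr 1; ring
  have hpi0 : Real.pi ^ (((r + m : ℕ) : ℝ) / 2) ≠ 0 := (Real.rpow_pos_of_pos Real.pi_pos _).ne'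
  have hs : √2 / 2 = (2 : ℝ) ^ (-(1 / 2) : ℝ) := by
    rw [Real.sqrt_eq_rpow, div_eq_iff two_ne_zero]
    have h := Real.rpow_add (two_pos (α := ℝ)) (-(1 / 2)) 1
    rw [Real.rpow_one] at h
    rw [← h]
    norm_num
  have h4 : (4 : ℝ) ^ (r * m) = (2 : ℝ) ^ ((2 * (r * m) : ℕ) : ℝ) := by
    rw [Real.rpow_natCast, pow_mul 2 2]; norm_num
  rw [tauConst, hpi, hs, h4, rootScale, ← Real.rpow_mul_natCast two_pos.le,
    ← Real.rpow_mul_natCast two_pos.le, ← Real.rpow_natCast 2 r,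
    ← Real.rpow_natCast 2 ((r + m).choose 2)]
  have e : ∀ a b c d f P : ℝ, P ≠ 0 → a * (b * P * c * d * (f / P)) = a * b * c * d * f := by
    intro a b c d f P hP; field_simp
  rw [e _ _ _ _ _ _ hpi0, ← Real.rpow_add two_pos, ← Real.rpow_add two_pos,
    ← Real.rpow_add two_pos, ← Real.rpow_add two_pos, ← Real.rpow_add two_pos]
  congr 1
  push_cast [Nat.cast_choose_two]
  ring

theorem tauCoeff_zero (r m : ℕ) : tauCoeff r m 0 =
    (-1) ^ (r / 2) * (((2 : ℝ) ^ ((m : ℝ) * (5 * r / 2 + 1)) : ℝ) : ℂ) *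
      (barnesG (r + 1) : ℂ) * (barnesG (m + 1) : ℂ) := by
  have hpi : (√Real.pi : ℂ) ≠ 0 := by
    exact_mod_cast (Real.sqrt_pos.2 Real.pi_pos).ne'
  have hγ : (rootScale : ℂ) ≠ 0 := by exact_mod_cast rootScale_pos.ne'
  have hK : (tauConst (r + m) : ℂ) ≠ 0 := by exact_mod_cast (tauConst_pos _).ne'
  have hr : (r.factorial : ℂ) ≠ 0 := by exact_mod_cast r.factorial_ne_zero
  have hm : (m.factorial : ℂ) ≠ 0 := by exact_mod_cast m.factorial_ne_zero
  have h : (4 : ℂ) ^ (r * m) * ((√2 : ℂ) / 2) ^ (r.choose 2 + m.choose 2) =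
      (((2 : ℝ) ^ ((m : ℝ) * (5 * r / 2 + 1)) : ℝ) : ℂ) * (2 ^ r * (√Real.pi : ℂ) ^ (r + m) *
        (rootScale : ℂ) ^ (r + m) * 2 ^ (r + m).choose 2 * (tauConst (r + m) : ℂ)) := by
    exact_mod_cast congrArg Complex.ofReal (two_pow_identity r m)
  rw [tauCoeff, add_zero, coeff_hankelSeries, neg_pow (√2 / 2 : ℂ), neg_one_pow_choose_two,
    tauFactor]
  rw [pow_add _ (r.choose 2)] at h
  generalize (((2 : ℝ) ^ ((m : ℝ) * (5 * r / 2 + 1)) : ℝ) : ℂ) = Y at *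
  rw [div_mul_eq_mul_div, one_mul, div_eq_iff (by simp [hpi, hγ, hK, hr, hm])]
  linear_combination ((r.factorial : ℂ) * m.factorial * (-1) ^ (r / 2) * barnesG (r + 1) *
    barnesG (m + 1)) * h

theorem airyTau_eq_sum (n : ℕ) (C₁ C₂ z : ℂ) :
    airyTau n C₁ C₂ z = ∑ r ∈ Finset.range (n + 1), C₁ ^ r * C₂ ^ (n - r) *
      mixedHankel r (n - r) (seedMomentAi z) (seedMomentBi z) := by
  rw [airyTau, ← det_hankel_add]
  simp_rw [iteratedDeriv_airySeed]

theorem mixedHankel_eq_tauAmplitude {n r : ℕ} (hr : r ≤ n) {z : ℂ} (hz : z ≠ 0) :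
    mixedHankel r (n - r) (seedMomentAi z) (seedMomentBi z) =
      (tauConst n : ℂ) * (-z) ^ (-((n : ℂ) ^ 2 / 4)) * (tauAmplitude r (n - r) z *
        Complex.exp ((Real.sqrt 2 : ℂ) / 3 * ((n : ℂ) - 2 * (r : ℂ)) * (-z) ^ (3 / 2 : ℂ))) := by
  obtain ⟨m, rfl⟩ := Nat.exists_eq_add_of_le hr
  have hK : (tauConst (r + m) : ℂ) ≠ 0 := by exact_mod_cast (tauConst_pos _).ne'
  have hP : (-z) ^ (-(((r + m : ℕ) : ℂ) ^ 2 / 4)) ≠ 0 := by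
    simp [Complex.cpow_eq_zero_iff, hz]
  rw [Nat.add_sub_cancel_left, tauAmplitude,
    show ((r + m : ℕ) : ℂ) - 2 * (r : ℂ) = (m : ℂ) - r by push_cast; ring]
  have hE := Complex.exp_ne_zero ((√2 : ℂ) / 3 * ((m : ℂ) - r) * (-z) ^ (3 / 2 : ℂ))
  field_simp

theorem theorem2p2 (n : ℕ) (hn : 1 ≤ n) :
    ∃ (A : ℂ → ℂ → ℕ → ℂ → ℂ) (a : ℂ → ℂ → ℕ → ℕ → ℂ),
      -- the dependence on the constants: `A_{n,r}` is `C₁^r C₂^(n-r)` times a function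
      -- that depends only on `n` and `r`, and so are the coefficients of its expansion
      (∃ (B : ℕ → ℂ → ℂ) (b : ℕ → ℕ → ℂ), ∀ (C₁ C₂ : ℂ) (r : ℕ), r ≤ n →
        (∀ z : ℂ, A C₁ C₂ r z = C₁ ^ r * C₂ ^ (n - r) * B r z) ∧
        (∀ j : ℕ, a C₁ C₂ r j = C₁ ^ r * C₂ ^ (n - r) * b r j)) ∧
      -- the leading coefficients
      (∀ (C₁ C₂ : ℂ) (r : ℕ), r ≤ n → a C₁ C₂ r 0 = tauLeadingCoeff n r C₁ C₂) ∧
      -- the general case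
      (∀ C₁ C₂ : ℂ, C₂ ≠ 0 →
        (∀ z : ℂ, z ≠ 0 → |Complex.arg (-z)| < Real.pi / 3 →
          airyTau n C₁ C₂ z =
            (tauConst n : ℂ) * (-z) ^ (-((n : ℂ) ^ 2 / 4)) *
              ∑ r ∈ Finset.range (n + 1), A C₁ C₂ r z *
                Complex.exp ((Real.sqrt 2 : ℂ) / 3 * ((n : ℂ) - 2 * (r : ℂ)) *
                  (-z) ^ (3 / 2 : ℂ))) ∧
        (∀ r : ℕ, r ≤ n →
          HasSectorExpansion (Real.pi / 3) (A C₁ C₂ r)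
            (3 / 2 * (r : ℂ) * ((n : ℂ) - (r : ℂ))) (a C₁ C₂ r))) ∧
      -- the case `C₂ = 0`
      (∀ C₁ : ℂ,
        (∀ z : ℂ, z ≠ 0 → |Complex.arg (-z)| < Real.pi →
          airyTau n C₁ 0 z =
            (tauConst n : ℂ) * (-z) ^ (-((n : ℂ) ^ 2 / 4)) * A C₁ 0 n z *
              Complex.exp (-((Real.sqrt 2 : ℂ) / 3 * (n : ℂ) * (-z) ^ (3 / 2 : ℂ)))) ∧
        HasSectorExpansion Real.pi (A C₁ 0 n) 0 (a C₁ 0 n)) := by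
  refine ⟨fun C₁ C₂ r z => C₁ ^ r * C₂ ^ (n - r) * tauAmplitude r (n - r) z,
    fun C₁ C₂ r j => C₁ ^ r * C₂ ^ (n - r) * tauCoeff r (n - r) j,
    ⟨fun r => tauAmplitude r (n - r), fun r => tauCoeff r (n - r),
      fun C₁ C₂ r _ => ⟨fun _ => rfl, fun _ => rfl⟩⟩, fun C₁ C₂ r hr => ?_,
    fun C₁ C₂ _ => ⟨fun z hz _ => ?_, fun r hr => ?_⟩, fun C₁ => ⟨fun z hz _ => ?_, ?_⟩⟩
  · simp only [tauCoeff_zero, tauLeadingCoeff, Nat.cast_sub hr]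
    ring
  · rw [airyTau_eq_sum, Finset.mul_sum]
    refine Finset.sum_congr rfl fun r hr => ?_
    rw [mixedHankel_eq_tauAmplitude (Nat.lt_succ_iff.1 (Finset.mem_range.1 hr)) hz]
    ring
  · exact hasSectorExpansion_tauAmplitude r (n - r) (by linarith [Real.pi_pos])
      (fun _ => le_rfl) _ (by rw [Nat.cast_sub hr])
  · rw [airyTau_eq_sum, Finset.sum_range_succ, Finset.sum_eq_zero, zero_add,
      mixedHankel_eq_tauAmplitude le_rfl hz]
    · rw [show (√2 : ℂ) / 3 * ((n : ℂ) - 2 * (n : ℂ)) * (-z) ^ (3 / 2 : ℂ) =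
        -((√2 : ℂ) / 3 * (n : ℂ) * (-z) ^ (3 / 2 : ℂ)) by ring]
      ring
    · intro r hr
      have := Finset.mem_range.1 hr
      rw [zero_pow (by omega), mul_zero, zero_mul]
  · exact hasSectorExpansion_tauAmplitude n (n - n) le_rfl (fun h => absurd (Nat.sub_self n) h) _
      (by simp)

end
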